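/- **Setting.** Fix a relational schema, a nonempty set $\mathbf C$ of constants, and a set $\Delta$ of parameterized discrete distributions: each $\delta\in\Delta$ maps a tuple $\bar p$ of parameters (constants, as many as the dimension of $\delta$) to a discrete probability distribution $\delta\langle\bar p\rangle$ on $\mathbf C$. A GDatalog$^\neg[\Delta]$ rule has the form $\rho: B\to R_0(\bar w)$, where $B$ is a finite conjunction of atoms and negated atoms, each entry of $\bar w$ is a term or a $\Delta$-term $\delta\langle\bar p\rangle[\bar q]$, and every variable of a negated atom or of the head occurs in a positive body atom. A program is a finite set of rules; it is positive (a GDatalog$[\Delta]$ program) if it has no negated atoms. Let $\mathrm{edb}(\Pi)$ be the set of predicates that occur in no rule head of $\Pi$; a database $D$ of $\mathrm{edb}(\Pi)$ is a finite set of ground atoms over $\mathrm{edb}(\Pi)$, and $\Pi[D]=\Pi\cup\{\to\alpha\mid\alpha\in D\}$. **The space induced by the simple grounder.** The TGD program $\Sigma_\Pi$ contains, for each rule $\rho$ with $\Delta$-terms $\delta_j\langle\bar p_j\rangle[\bar q_j]$ ($1\le j\le r$) in its head, the TGDs $B\to \mathrm{Active}^{\delta_j}_{|\bar q_j|}(\bar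 p_j,\bar q_j)$ and $\mathrm{Active}^{\delta_j}_{|\bar q_j|}(\bar p_j,\bar q_j)\to\exists y_j\,\mathrm{Result}^{\delta_j}_{|\bar q_j|}(\bar p_j,\bar q_j,y_j)$ for each $j$, and $\mathrm{Result}^{\delta_1}_{|\bar q_1|}(\bar p_1,\bar q_1,y_1),\dots,\mathrm{Result}^{\delta_r}_{|\bar q_r|}(\bar p_r,\bar q_r,y_r),B\to R_0(\bar w')$, where $\bar w'$ is $\bar w$ with the $\Delta$-terms replaced by the fresh variables $y_1,\dots,y_r$ (for $r=0$ this is $\rho$ itself). For a set $A$ of ground instances $\mathrm{Active}^{\delta}_n(\bar p,\bar q)\to \mathrm{Result}^\delta_n(\bar p,\bar q,o)$ of the existential TGDs of $\Sigma_\Pi$, with at most one $o$ for each $\mathrm{Active}$ atom, let $G_\Pi(A)$ (the simple grounder $\mathit{GSimple}_\Pi$) be the least set $X$ containing every ground instance of an existential-free TGD of $\Sigma_\Pi$ whose positive body atoms are all heads of rules in $A\cup X$. Such a set $A$ is a terminal if for every $\mathrm{Active}$ atom that is the head of a rule in $G_\Pi(A)$ it contains a rule with that atom as its body. A possible outcome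 is a set $\Sigma=A\cup G_\Pi(A)$, with $A$ a $\subseteq$-minimal terminal, such that $\delta\langle\bar p\rangle(o)>0$ for every $\mathrm{Result}^\delta_n(\bar p,\bar q,o)$ that is the head of a rule in $\Sigma$. Let $\Omega$ be the set of possible outcomes, $\Omega^{\rm fin}$ and $\Omega^\infty$ the sets of finite and of infinite ones, and for $\Sigma\in\Omega^{\rm fin}$ let $\Pr(\Sigma)$ be the product of $\delta\langle\bar p\rangle(o)$ over all distinct atoms $\mathrm{Result}^\delta_n(\bar p,\bar q,o)$ among the heads of $\Sigma$. Events are the members of the $\sigma$-algebra generated by $\Omega^\infty$ and the maximal sets $E\subseteq\Omega^{\rm fin}$ all of whose members have the same stable models; the probability measure satisfies $P(E)=\sum_{\Sigma\in E}\Pr(\Sigma)$ for each such $E$, and $P(\Omega^\infty)=1-\sum_{\Sigma\in\Omega^{\rm fin}}\Pr(\Sigma)$. Applying this to the program $\Pi[D]$ gives the space induced by the simple grounder on $D$. The simple grounder is finitely grounding for $\Pi[D]$ if $\Omega^\infty=\emptyset$. **The BCKOV space** (Bárány, ten Cate, Kimelfeld, Olteanu, Vagena), for positive $\Pi$. Let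 $\widetilde{\Sigma}_\Pi$ be defined as $\Sigma_\Pi$, except that the two TGDs for each $j$ are replaced by the single TGD $B\to\exists y_j\,\mathrm{Result}^{\delta_j}_{|\bar q_j|}(\bar p_j,\bar q_j,y_j)$. A BCKOV possible outcome is a $\subseteq$-minimal set $I$ of ground atoms among those that contain $D$ and satisfy $\widetilde{\Sigma}_\Pi$, such that $\delta\langle\bar p\rangle(o)>0$ for every $\mathrm{Result}^\delta_n(\bar p,\bar q,o)\in I$. For a set $F$ of ground atoms let $\Omega^{F\subseteq}$ be the set of BCKOV possible outcomes $I\supseteq F$. Events are the members of the $\sigma$-algebra generated by the sets $\Omega^{F\subseteq}$ with $F$ finite. The probability measure is the one with $Q(\Omega^{F\subseteq})=\prod_{\mathrm{Result}^\delta_n(\bar p,\bar q,o)\in F}\delta\langle\bar p\rangle(o)$ for every $F=\{f_1,\dots,f_n\}$ such that $f_1,\dots,f_n$ is a derivation, that is, each $f_i$ is the head of an instance of a TGD of $\widetilde{\Sigma}_\Pi$ (with a constant chosen for the existential variable, if any) whose body holds in $J_{i-1}=D\cup\{f_1,\dots,f_{i-1}\}$ and whose (existentially quantified) head does not hold in $J_{i-1}$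 under the same assignment of the body variables. **Theorem.** Let $\Pi$ be a positive GDatalog$[\Delta]$ program and $D$ a database of $\mathrm{edb}(\Pi)$ such that the simple grounder is finitely grounding for $\Pi[D]$. Then there is exactly one probability measure $P$ and exactly one probability measure $Q$ as above, every possible outcome $\Sigma$ has exactly one stable model, and the map $f$ that sends $\Sigma$ to its stable model with all $\mathrm{Active}$ atoms removed is an isomorphism from the probability space induced by the simple grounder onto the BCKOV probability space: $f$ is a bijection between the two sets of possible outcomes; a set $F$ of possible outcomes is an event if and only if $f(F)$ is; and $P(F)=Q(f(F))$ for every event $F$. -/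

import Mathlib

open MeasureTheory
open scoped ENNReal

universe u v w

namespace GDatalog

/-- The ambient vocabulary: a relational schema, a set of constants, and a set `Δ` (here `Dist`) of
parameterized discrete probability distributions.  A distribution `δ` of dimension `dim δ` assigns
to every tuple of parameters a discrete probability distribution over the constants (a distribution
over a countable set `Ω` of constants is a `PMF` whose support lies in `Ω`). -/
structure Vocabulary where
  Rel : Type u
  arity : Rel → ℕ
  Const : Type v
  Dist : Type w
  dim : Dist → ℕ
  law : (δ : Dist) → (Fin (dim δ) → Const) → PMF Const

variable (S : Vocabulary.{u, v, w})

/-- Terms: variables (from `X`) and constants. -/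
inductive Term (X : Type) : Type v
  | var (x : X)
  | const (c : S.Const)

/-- Atoms `R(t₁, …, tₙ)` over the schema, with arguments in `T`. -/
structure RelAtom (T : Type v) : Type (max u v) where
  rel : S.Rel
  args : Fin (S.arity rel) → T

/-- Atoms over the schema extended with the fresh predicates `Active^δ_{|q|}` and
`Result^δ_{|q|}`; the index `|q|` of the predicate is the length of the list `q`. -/
inductive Atom (T : Type v) : Type (max u v w)
  | base (a : RelAtom S T)
  | active (δ : S.Dist) (p : Fin (S.dim δ) → T) (q : List T)
  | result (δ : S.Dist) (p : Fin (S.dim δ) → T) (q : List T) (o : T)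

/-- Entries of a rule head: terms, and `Δ`-terms `δ⟨p⟩[q]`. -/
inductive HeadTerm : Type (max v w)
  | term (t : Term S ℕ)
  | sample (δ : S.Dist) (p : Fin (S.dim δ) → Term S ℕ) (q : List (Term S ℕ))

variable {S}

/-- The value of a term under an assignment of constants to variables. -/
def Term.eval {X : Type} (h : X → S.Const) : Term S X → S.Const
  | .var x => h x
  | .const c => c

/-- The variables of a term. -/
def Term.vars {X : Type} : Term S X → Set X
  | .var x => {x}
  | .const _ => ∅

def RelAtom.map {T T' : Type v} (f : T → T') (a : RelAtom S T) : RelAtom S T' :=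
  ⟨a.rel, fun i => f (a.args i)⟩

def Atom.map {T T' : Type v} (f : T → T') : Atom S T → Atom S T'
  | .base a => .base (a.map f)
  | .active δ p q => .active δ (fun i => f (p i)) (q.map f)
  | .result δ p q o => .result δ (fun i => f (p i)) (q.map f) (f o)

/-- The variables of an atom over the schema. -/
def RelAtom.vars {X : Type} (a : RelAtom S (Term S X)) : Set X :=
  {x | ∃ i, x ∈ (a.args i).vars}

/-- The variables of an atom over the extended schema. -/
def Atom.vars {X : Type} : Atom S (Term S X) → Set X
  | .base a => a.vars
  | .active _ p q => {x | (∃ i, x ∈ (p i).vars) ∨ ∃ t ∈ q, x ∈ t.vars}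
  | .result _ p q o => {x | (∃ i, x ∈ (p i).vars) ∨ (∃ t ∈ q, x ∈ t.vars) ∨ x ∈ o.vars}

/-- The variables of a head entry. -/
def HeadTerm.vars : HeadTerm S → Set ℕ
  | .term t => t.vars
  | .sample _ p q => {x | (∃ i, x ∈ (p i).vars) ∨ ∃ t ∈ q, x ∈ t.vars}

variable (S)

/-- A rule `R₁(u₁), …, Rₙ(uₙ), ¬P₁(v₁), …, ¬Pₘ(vₘ) → R₀(w)` of generative Datalog with negation:
the entries of `w` are terms or `Δ`-terms, and the rule is safe, that is, every variable of the
negative body and of the head occurs in the positive body. -/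
structure Rule where
  pos : List (RelAtom S (Term S ℕ))
  neg : List (RelAtom S (Term S ℕ))
  headRel : S.Rel
  headArgs : Fin (S.arity headRel) → HeadTerm S
  safe_neg : ∀ a ∈ neg, ∀ x ∈ a.vars, ∃ b ∈ pos, x ∈ b.vars
  safe_head : ∀ i, ∀ x ∈ (headArgs i).vars, ∃ b ∈ pos, x ∈ b.vars

/-- A program is a set of rules (finiteness is a separate hypothesis). -/
abbrev Program := Set (Rule S)

/-- Ground atoms over the extended schema. -/
abbrev GroundAtom := Atom S S.Const

/-- A tuple-generating dependency `B⁺, ¬B⁻ → ∃ z̄ H` whose atoms have arguments in `T`.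
When `T` is a type of terms, the existentially quantified variables are the variables of
the head that do not occur in the body; when `T` is the type of constants it is ground. -/
@[ext]
structure TGD (T : Type v) : Type (max u v w) where
  pos : List (Atom S T)
  neg : List (Atom S T)
  head : Atom S T

/-- Variables of TGDs: the variables `Sum.inl x` of the rules, and fresh variables
`Sum.inr i`, the variable used for the `Δ`-term at position `i` of a rule head. -/
abbrev TVar := ℕ ⊕ ℕ

/-- Nonground TGDs. -/
abbrev VTGD := TGD S (Term S TVar)

/-- Ground TGDs without existential quantification. -/
abbrev GroundRule := TGD S S.Const

variable {S}

/-- A program is positive if no negative literal occurs in its rules. -/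
def Program.IsPositive (Pi : Program S) : Prop := ∀ ρ ∈ Pi, ρ.neg = []

/-- The extensional predicates: those that occur in no rule head. -/
def Program.edb (Pi : Program S) : Set S.Rel := {R | ∀ ρ ∈ Pi, ρ.headRel ≠ R}

/-- The rule `→ α` of a ground atom `α`. -/
def Rule.ofFact (a : RelAtom S S.Const) : Rule S where
  pos := []
  neg := []
  headRel := a.rel
  headArgs := fun i => .term (.const (a.args i))
  safe_neg := by simp
  safe_head := by simp [HeadTerm.vars, Term.vars]

/-- `Π[D] = Π ∪ {→ α | α ∈ D}`. -/
def Program.withFacts (Pi : Program S) (D : Set (RelAtom S S.Const)) : Program S :=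
  Pi ∪ Rule.ofFact '' D

/-! ### Tuple-generating dependencies -/

/-- The instance `h(σ)` of a TGD under an assignment `h`. -/
def TGD.subst (h : TVar → S.Const) (σ : VTGD S) : GroundRule S :=
  ⟨σ.pos.map (Atom.map (Term.eval h)), σ.neg.map (Atom.map (Term.eval h)),
    σ.head.map (Term.eval h)⟩

def TGD.bodyVars (σ : VTGD S) : Set TVar :=
  {x | (∃ a ∈ σ.pos, x ∈ a.vars) ∨ ∃ a ∈ σ.neg, x ∈ a.vars}

/-- The TGD has an existentially quantified variable. -/
def TGD.IsExistential (σ : VTGD S) : Prop := ∃ x ∈ σ.head.vars, x ∉ σ.bodyVars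

/-- `h` maps the body of `σ` to the instance `I`. -/
def TGD.IsTrigger (σ : VTGD S) (h : TVar → S.Const) (I : Set (GroundAtom S)) : Prop :=
  (∀ a ∈ (σ.subst h).pos, a ∈ I) ∧ ∀ a ∈ (σ.subst h).neg, a ∉ I

/-- For the values that `h` gives to the body variables of `σ`, the head of `σ` holds in `I`. -/
def TGD.HeadHolds (σ : VTGD S) (h : TVar → S.Const) (I : Set (GroundAtom S)) : Prop :=
  ∃ h' : TVar → S.Const, (∀ x ∈ σ.bodyVars, h' x = h x) ∧ (σ.subst h').head ∈ I

/-- The instance `I` satisfies the TGD `σ`. -/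
def TGD.SatisfiedBy (σ : VTGD S) (I : Set (GroundAtom S)) : Prop :=
  ∀ h : TVar → S.Const, σ.IsTrigger h I → σ.HeadHolds h I

/-- All ground instances of a set of TGDs. -/
def ground (Sig : Set (VTGD S)) : Set (GroundRule S) := {r | ∃ σ ∈ Sig, ∃ h, r = σ.subst h}

/-- The existential TGDs of a set of TGDs. -/
def exPart (Sig : Set (VTGD S)) : Set (VTGD S) := {σ ∈ Sig | σ.IsExistential}

/-- The existential-free TGDs of a set of TGDs. -/
def nonexPart (Sig : Set (VTGD S)) : Set (VTGD S) := {σ ∈ Sig | ¬ σ.IsExistential}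

def heads (Sig : Set (GroundRule S)) : Set (GroundAtom S) := TGD.head '' Sig

/-! ### Stable models of ground programs -/

/-- `J` satisfies the reduct of the ground rule `r` relative to `I`: negative literals are
evaluated in `I`, positive ones in `J`. -/
def TGD.ReductHolds (r : GroundRule S) (I J : Set (GroundAtom S)) : Prop :=
  (∀ a ∈ r.pos, a ∈ J) → (∀ a ∈ r.neg, a ∉ I) → r.head ∈ J

/-- `I` is a stable model of the ground program `Sig`. -/
def IsStableModel (Sig : Set (GroundRule S)) (I : Set (GroundAtom S)) : Prop :=
  (∀ r ∈ Sig, r.ReductHolds I I) ∧ ¬ ∃ J, J ⊂ I ∧ ∀ r ∈ Sig, r.ReductHolds I J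

/-- The set of stable models. -/
def sms (Sig : Set (GroundRule S)) : Set (Set (GroundAtom S)) := {I | IsStableModel Sig I}

/-! ### Translations of programs into TGDs -/

/-- View a term of a rule as a term of a TGD. -/
def Term.lift : Term S ℕ → Term S TVar
  | .var x => .var (.inl x)
  | .const c => .const c

/-- View an atom of a rule as an atom of a TGD. -/
def RelAtom.lift (a : RelAtom S (Term S ℕ)) : Atom S (Term S TVar) := .base (a.map Term.lift)

/-- `Active^δ(p, q)` as an atom of a TGD. -/
def activeAtom (δ : S.Dist) (p : Fin (S.dim δ) → Term S ℕ) (q : List (Term S ℕ)) :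
    Atom S (Term S TVar) :=
  .active δ (fun i => (p i).lift) (q.map Term.lift)

/-- `Result^δ(p, q, yᵢ)` as an atom of a TGD, with the fresh variable `yᵢ`. -/
def resultAtom (i : ℕ) (δ : S.Dist) (p : Fin (S.dim δ) → Term S ℕ) (q : List (Term S ℕ)) :
    Atom S (Term S TVar) :=
  .result δ (fun i => (p i).lift) (q.map Term.lift) (.var (.inr i))

/-- The head entry at position `i`, a `Δ`-term being replaced with `yᵢ`. -/
def HeadTerm.replace (i : ℕ) : HeadTerm S → Term S TVar
  | .term t => t.lift
  | .sample _ _ _ => .var (.inr i)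

/-- The result atom that belongs to the head entry at position `i`, if that is a `Δ`-term. -/
def HeadTerm.result? (i : ℕ) : HeadTerm S → Option (Atom S (Term S TVar))
  | .term _ => none
  | .sample δ p q => some (resultAtom i δ p q)

/-- The TGDs `B → Active^δ(p, q)`, one for each `Δ`-term `δ⟨p⟩[q]` of the head. -/
def Rule.activeTGDs (ρ : Rule S) : Set (VTGD S) :=
  {σ | ∃ i δ p q, ρ.headArgs i = .sample δ p q ∧
    σ = ⟨ρ.pos.map RelAtom.lift, ρ.neg.map RelAtom.lift, activeAtom δ p q⟩}

/-- The active-to-result TGDs `Active^δ(p, q) → ∃ y Result^δ(p, q, y)`. -/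
def Rule.atrTGDs (ρ : Rule S) : Set (VTGD S) :=
  {σ | ∃ (i : Fin (S.arity ρ.headRel)) (δ : _) (p : _) (q : _), ρ.headArgs i = .sample δ p q ∧
    σ = ⟨[activeAtom δ p q], [], resultAtom i δ p q⟩}

/-- The TGDs `B → ∃ y Result^δ(p, q, y)`, one for each `Δ`-term `δ⟨p⟩[q]` of the head. -/
def Rule.existsTGDs (ρ : Rule S) : Set (VTGD S) :=
  {σ | ∃ (i : Fin (S.arity ρ.headRel)) (δ : _) (p : _) (q : _), ρ.headArgs i = .sample δ p q ∧
    σ = ⟨ρ.pos.map RelAtom.lift, ρ.neg.map RelAtom.lift, resultAtom i δ p q⟩}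

/-- The TGD `Result₁, …, Result_r, B → R₀(w')`, where `w'` is obtained from the head `w` by
replacing its `r` many `Δ`-terms with fresh variables.  For `r = 0` this is the rule itself. -/
def Rule.finalTGD (ρ : Rule S) : VTGD S where
  pos := (List.finRange (S.arity ρ.headRel)).filterMap
      (fun i => (ρ.headArgs i).result? i) ++ ρ.pos.map RelAtom.lift
  neg := ρ.neg.map RelAtom.lift
  head := .base ⟨ρ.headRel, fun i => (ρ.headArgs i).replace i⟩

/-- The TGD program `Σ_Π` (with active-to-result TGDs). -/
def Program.toTGDs (Pi : Program S) : Set (VTGD S) :=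
  {σ | ∃ ρ ∈ Pi, σ ∈ ρ.activeTGDs ∨ σ ∈ ρ.atrTGDs ∨ σ = ρ.finalTGD}

/-- The TGD program of Bárány et al. (without active-to-result TGDs). -/
def Program.toTGDsBCKOV (Pi : Program S) : Set (VTGD S) :=
  {σ | ∃ ρ ∈ Pi, σ ∈ ρ.existsTGDs ∨ σ = ρ.finalTGD}

/-! ### Probabilities of sets of atoms -/

/-- `δ⟨p⟩(o)` for an atom `Result^δ(p, q, o)`, and `1` for every other atom. -/
noncomputable def Atom.prob : GroundAtom S → ℝ≥0∞
  | .result δ p _ o => S.law δ p o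
  | _ => 1

/-- The product of the probabilities of the atoms of `F`; it is used for finite sets `F` only. -/
noncomputable def atomsProb (F : Set (GroundAtom S)) : ℝ≥0∞ := ∏ᶠ a ∈ F, a.prob

/-! ### The semantics induced by a grounder -/

/-- The ground active-to-result TGD `Active^δ(p, q) → Result^δ(p, q, o)`. -/
def atr (δ : S.Dist) (p : Fin (S.dim δ) → S.Const) (q : List S.Const) (o : S.Const) :
    GroundRule S :=
  ⟨[.active δ p q], [], .result δ p q o⟩

/-- The functionally consistent sets of ground active-to-result TGDs of `Pi`: at most one
result is chosen for each active atom. -/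
def Program.consistentSets (Pi : Program S) : Set (Set (GroundRule S)) :=
  {A | A ⊆ ground (exPart Pi.toTGDs) ∧
    ∀ δ p q o o', atr δ p q o ∈ A → atr δ p q o' ∈ A → o = o'}

/-- The set `A` of ground active-to-result TGDs is compatible with the ground program `Sig`: it
chooses a result for every active atom in the heads of `Sig`. -/
def Compatible (A Sig : Set (GroundRule S)) : Prop :=
  ∀ δ p q, Atom.active δ p q ∈ heads Sig → ∃ o, atr δ p q o ∈ A

/-- The terminals of `G`, a map from consistent sets to sets of ground rules. -/
def Program.terminals (Pi : Program S) (G : Set (GroundRule S) → Set (GroundRule S)) :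
    Set (Set (GroundRule S)) :=
  {A ∈ Pi.consistentSets | Compatible A (G A)}

/-- The groundings of `Pi` relative to `G`: the sets `A ∪ G(A)` for `⊆`-minimal terminals `A`. -/
def Program.groundings (Pi : Program S) (G : Set (GroundRule S) → Set (GroundRule S)) :
    Set (Set (GroundRule S)) :=
  {Sig | ∃ A, Minimal (· ∈ Pi.terminals G) A ∧ Sig = A ∪ G A}

/-- One step of the simple grounder on the existential-free TGDs `N`: all instances of TGDs of `N`
whose positive body atoms are heads of rules in `A` or among those derived so far. -/
def simpleStep (N : Set (VTGD S)) (A : Set (GroundRule S)) :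
    Set (GroundRule S) →o Set (GroundRule S) where
  toFun X := {r ∈ ground N | ∀ a ∈ r.pos, a ∈ heads (A ∪ X)}
  monotone' := fun _ _ hXY _ hr =>
    ⟨hr.1, fun a ha => Set.image_mono (Set.union_subset_union_right A hXY) (hr.2 a ha)⟩

/-- The simple grounder of `Pi`. -/
def Program.gsimple (Pi : Program S) (A : Set (GroundRule S)) : Set (GroundRule S) :=
  OrderHom.lfp (simpleStep (nonexPart Pi.toTGDs) A)

/-- The possible outcomes of `Pi` relative to `G`. -/
@[ext]
structure Outcome (Pi : Program S) (G : Set (GroundRule S) → Set (GroundRule S)) where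
  prog : Set (GroundRule S)
  mem_groundings : prog ∈ Pi.groundings G
  prob_pos : ∀ δ p q o, Atom.result δ p q o ∈ heads prog → 0 < S.law δ p o

section
variable (Pi : Program S) (G : Set (GroundRule S) → Set (GroundRule S))

/-- `G` is finitely grounding: every possible outcome is finite. -/
def FinitelyGrounding : Prop := ∀ x : Outcome Pi G, x.prog.Finite

/-- The finite possible outcomes. -/
def Outcome.fin : Set (Outcome Pi G) := {x | x.prog.Finite}

/-- The infinite possible outcomes. -/
def Outcome.inf : Set (Outcome Pi G) := {x | ¬ x.prog.Finite}

/-- The maximal sets of finite possible outcomes with the same stable models. -/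
def Outcome.IsBlock (E : Set (Outcome Pi G)) : Prop :=
  Maximal (fun E : Set (Outcome Pi G) =>
    E ⊆ Outcome.fin Pi G ∧ ∀ x ∈ E, ∀ y ∈ E, sms x.prog = sms y.prog) E

/-- The σ-algebra generated by the set of infinite possible outcomes and the maximal sets of
finite possible outcomes with the same stable models. -/
instance : MeasurableSpace (Outcome Pi G) :=
  MeasurableSpace.generateFrom ({Outcome.inf Pi G} ∪ {E | Outcome.IsBlock Pi G E})

/-- The probability of a finite possible outcome. -/
noncomputable def Outcome.pr {Pi : Program S} {G : Set (GroundRule S) → Set (GroundRule S)}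
    (x : Outcome Pi G) : ℝ≥0∞ :=
  atomsProb (heads x.prog)

/-- `P` is the probability measure of the space induced by `G`. -/
structure IsOutputMeasure (P : Measure (Outcome Pi G)) : Prop where
  isProbabilityMeasure : IsProbabilityMeasure P
  block : ∀ E, Outcome.IsBlock Pi G E → P E = ∑' x : E, x.1.pr
  infinite : P (Outcome.inf Pi G) = 1 - ∑' x : Outcome.fin Pi G, x.1.pr

end

/-! ### The semantics of Bárány, ten Cate, Kimelfeld, Olteanu and Vagena (BCKOV) -/

/-- `I` is a model of `Σ̃_Π` that contains `D`. -/
def IsModelBCKOV (Pi : Program S) (D : Set (RelAtom S S.Const)) (I : Set (GroundAtom S)) :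
    Prop :=
  Atom.base '' D ⊆ I ∧ ∀ σ ∈ Pi.toTGDsBCKOV, σ.SatisfiedBy I

/-- The BCKOV possible outcomes: the `⊆`-minimal models all of whose results have positive
probability. -/
@[ext]
structure OutcomeBCKOV (Pi : Program S) (D : Set (RelAtom S S.Const)) where
  inst : Set (GroundAtom S)
  minimal : Minimal (IsModelBCKOV Pi D) inst
  prob_pos : ∀ δ p q o, Atom.result δ p q o ∈ inst → 0 < S.law δ p o

section
variable (Pi : Program S) (D : Set (RelAtom S S.Const))

/-- The BCKOV possible outcomes that contain `F`. -/
def OutcomeBCKOV.above (F : Set (GroundAtom S)) : Set (OutcomeBCKOV Pi D) := {I | F ⊆ I.inst}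

/-- The σ-algebra generated by the sets `above F` for finite `F`. -/
instance : MeasurableSpace (OutcomeBCKOV Pi D) :=
  MeasurableSpace.generateFrom {E | ∃ F : Set (GroundAtom S), F.Finite ∧
    E = OutcomeBCKOV.above Pi D F}

/-- `f₁, …, fₙ` is a derivation: each entry is the head of an instance of a TGD that is applicable
to `D` and the preceding entries, that is, whose body holds there and whose head does not. -/
def IsDerivation (f : List (GroundAtom S)) : Prop :=
  ∀ (i : ℕ) (hi : i < f.length), ∃ σ ∈ Pi.toTGDsBCKOV, ∃ h : TVar → S.Const,
    σ.IsTrigger h (Atom.base '' D ∪ {a | a ∈ f.take i}) ∧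
    ¬ σ.HeadHolds h (Atom.base '' D ∪ {a | a ∈ f.take i}) ∧
    f[i] = (σ.subst h).head

/-- `Q` is the probability measure of the BCKOV space. -/
structure IsOutputMeasureBCKOV (Q : Measure (OutcomeBCKOV Pi D)) : Prop where
  isProbabilityMeasure : IsProbabilityMeasure Q
  derivation : ∀ f, IsDerivation Pi D f →
    Q (OutcomeBCKOV.above Pi D {a | a ∈ f}) = atomsProb {a | a ∈ f}

end

/-! ### Comparing the two semantics -/

/-- An isomorphism of probability spaces. -/
structure IsProbIso {A : Type*} {B : Type*} [MeasurableSpace A] [MeasurableSpace B]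
    (P : Measure A) (Q : Measure B) (f : A → B) : Prop where
  bijective : Function.Bijective f
  measurableSet_iff : ∀ F : Set A, MeasurableSet F ↔ MeasurableSet (f '' F)
  measure_eq : ∀ F : Set A, MeasurableSet F → P F = Q (f '' F)

/-- The instance `I` modulo active: all atoms `Active^δ(p, q)` are removed. -/
def moduloActive (I : Set (GroundAtom S)) : Set (GroundAtom S) :=
  {a ∈ I | ∀ δ p q, a ≠ .active δ p q}

end GDatalog

/-!
The proof describes the possible outcomes of both semantics by the choices made in them.

A set `A` of ground active-to-result TGDs has a closure: the least model of `A` together with the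
ground existential-free rules. A terminal is minimal if and only if each of its choices is
supported, that is, belongs to an active atom in the closure (`Program.supported_of_minimal`,
`Program.IsComplete.minimal`); for in any terminal the choices that fire form a terminal. Hence
possible outcomes correspond to the complete sets of choices, those that are functionally
consistent, supported, of positive probability, and decide every active atom in their closure. The
heads of an outcome are the closure of its choices. As there is no negation, they form its only
stable model (`Outcome.mem_sms_iff`), and the outcome can be recovered from them.

The probabilities of the outcomes that extend a partial set of choices `A` add up to the product of
the probabilities of the choices in `A` (`Program.IsPartial.mass_eq`). This holds if `A` is
complete. Otherwise `A` has an open active atom, and it holds for `A` if it holds after each of the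
possible choices for that atom, since these have total probability `1`. This recursion is
well-founded: every partial set of choices extends to a possible outcome and so is finite, and
unions of chains of partial sets are partial. For `A = ∅` the total probability is `1`.
Consequently there are only countably many outcomes, all sets of outcomes are events, and the
measure is a sum of point masses.

On the other side, a set of atoms is a BCKOV model if and only if it is closed under the
existential-free rules when `Active^δ(p, q)` is read as `∃ y Result^δ(p, q, y)`
(`isModelBCKOV_iff`). Therefore removing the active atoms from the heads of an outcome gives a
minimal model, and each minimal model arises in this way from the choices it contains
(`Outcome.toBCKOV_injective`, `Outcome.toBCKOV_surjective`). A BCKOV outcome contains the atoms of a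
derivation if and only if the choices in the derivation are made in the corresponding possible
outcome (`IsDerivation.subset_iff`), so that the formula for extensions of partial sets yields the
defining property of the BCKOV measure. Every finite BCKOV outcome is enumerated by some derivation
(`OutcomeBCKOV.exists_isDerivation`) and is the only outcome containing it, which determines the
measure on singletons.
-/

namespace GDatalog

variable {S : Vocabulary.{u, v, w}}

/-! ### Substitutions, existential variables and the two translations -/

theorem Term.eval_congr {X : Type} {h h' : X → S.Const} {t : Term S X}
    (H : ∀ x ∈ t.vars, h x = h' x) : t.eval h = t.eval h' := by
  cases t with
  | var x => exact H x rfl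
  | const c => rfl

theorem Term.vars_lift (t : Term S ℕ) : t.lift.vars = Sum.inl '' t.vars := by
  cases t <;> simp [Term.lift, Term.vars]

theorem RelAtom.vars_lift (a : RelAtom S (Term S ℕ)) : a.lift.vars = Sum.inl '' a.vars := by
  ext x
  simp only [RelAtom.lift, Atom.vars, RelAtom.vars, RelAtom.map, Term.vars_lift, Set.mem_image,
    Set.mem_ofPred_eq]
  constructor
  · rintro ⟨i, y, hy, rfl⟩
    exact ⟨y, ⟨i, hy⟩, rfl⟩
  · rintro ⟨y, ⟨i, hy⟩, rfl⟩
    exact ⟨i, y, hy, rfl⟩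

theorem Atom.map_eval_congr {X : Type} {h h' : X → S.Const} {a : Atom S (Term S X)}
    (H : ∀ x ∈ a.vars, h x = h' x) : a.map (Term.eval h) = a.map (Term.eval h') := by
  cases a with
  | base a =>
    simp only [Atom.map, RelAtom.map, Atom.base.injEq, RelAtom.mk.injEq, heq_eq_eq, true_and]
    exact funext fun i => Term.eval_congr fun x hx => H x ⟨i, hx⟩
  | active δ p q =>
    have hp : ∀ i, (p i).eval h = (p i).eval h' :=
      fun i => Term.eval_congr fun x hx => H x (Or.inl ⟨i, hx⟩)
    have hq : q.map (Term.eval h) = q.map (Term.eval h') :=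
      List.map_congr_left fun t ht => Term.eval_congr fun x hx => H x (Or.inr ⟨t, ht, hx⟩)
    simp only [Atom.map, hp, hq]
  | result δ p q o =>
    have hp : ∀ i, (p i).eval h = (p i).eval h' :=
      fun i => Term.eval_congr fun x hx => H x (Or.inl ⟨i, hx⟩)
    have hq : q.map (Term.eval h) = q.map (Term.eval h') :=
      List.map_congr_left fun t ht => Term.eval_congr fun x hx => H x (Or.inr (Or.inl ⟨t, ht, hx⟩))
    have ho : o.eval h = o.eval h' := Term.eval_congr fun x hx => H x (Or.inr (Or.inr hx))
    simp only [Atom.map, hp, hq, ho]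

theorem TGD.subst_pos_congr {σ : VTGD S} {h h' : TVar → S.Const}
    (H : ∀ x ∈ σ.bodyVars, h x = h' x) : (σ.subst h).pos = (σ.subst h').pos :=
  List.map_congr_left fun a ha => Atom.map_eval_congr fun x hx => H x (Or.inl ⟨a, ha, hx⟩)

theorem TGD.subst_neg_congr {σ : VTGD S} {h h' : TVar → S.Const}
    (H : ∀ x ∈ σ.bodyVars, h x = h' x) : (σ.subst h).neg = (σ.subst h').neg :=
  List.map_congr_left fun a ha => Atom.map_eval_congr fun x hx => H x (Or.inr ⟨a, ha, hx⟩)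

theorem TGD.isTrigger_congr {σ : VTGD S} {h h' : TVar → S.Const} {I : Set (GroundAtom S)}
    (H : ∀ x ∈ σ.bodyVars, h x = h' x) : σ.IsTrigger h I ↔ σ.IsTrigger h' I := by
  rw [TGD.IsTrigger, TGD.IsTrigger, TGD.subst_pos_congr H, TGD.subst_neg_congr H]

theorem TGD.headHolds_congr {σ : VTGD S} {h h' : TVar → S.Const} {I : Set (GroundAtom S)}
    (H : ∀ x ∈ σ.bodyVars, h x = h' x) : σ.HeadHolds h I ↔ σ.HeadHolds h' I := by
  constructor
  · rintro ⟨k, hk, hI⟩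
    exact ⟨k, fun x hx => (hk x hx).trans (H x hx), hI⟩
  · rintro ⟨k, hk, hI⟩
    exact ⟨k, fun x hx => (hk x hx).trans (H x hx).symm, hI⟩

theorem TGD.headHolds_iff_of_not_isExistential {σ : VTGD S} (hσ : ¬ σ.IsExistential)
    {h : TVar → S.Const} {I : Set (GroundAtom S)} :
    σ.HeadHolds h I ↔ (σ.subst h).head ∈ I := by
  constructor
  · rintro ⟨k, hk, hI⟩
    have : (σ.subst k).head = (σ.subst h).head :=
      Atom.map_eval_congr fun x hx => hk x (by_contra fun hb => hσ ⟨x, hx, hb⟩)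
    exact this ▸ hI
  · exact fun hI => ⟨h, fun _ _ => rfl, hI⟩

/-- The body of `ρ` with a given head, as a TGD. -/
def Rule.bodyTGD (ρ : Rule S) (a : Atom S (Term S TVar)) : VTGD S :=
  ⟨ρ.pos.map RelAtom.lift, ρ.neg.map RelAtom.lift, a⟩

theorem Rule.inl_mem_bodyVars (ρ : Rule S) (a : Atom S (Term S TVar))
    (i : Fin (S.arity ρ.headRel)) {x : ℕ} (hx : x ∈ (ρ.headArgs i).vars) :
    Sum.inl x ∈ (ρ.bodyTGD a).bodyVars := by
  obtain ⟨b, hb, hxb⟩ := ρ.safe_head i x hx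
  exact Or.inl ⟨b.lift, List.mem_map_of_mem hb, by rw [RelAtom.vars_lift]; exact ⟨x, hxb, rfl⟩⟩

theorem Rule.inr_notMem_bodyVars (ρ : Rule S) (a : Atom S (Term S TVar)) (k : ℕ) :
    Sum.inr k ∉ (ρ.bodyTGD a).bodyVars := by
  rintro (⟨b, hb, hx⟩ | ⟨b, hb, hx⟩) <;>
  · obtain ⟨c, -, rfl⟩ := List.mem_map.1 hb
    rw [RelAtom.vars_lift] at hx
    simp at hx

/-- The variables of `Active^δ(p, q)` are variables of the `Δ`-term `δ⟨p⟩[q]`. -/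
theorem vars_activeAtom (δ : S.Dist) (p : Fin (S.dim δ) → Term S ℕ) (q : List (Term S ℕ)) :
    (activeAtom δ p q).vars = Sum.inl '' (HeadTerm.sample δ p q).vars := by
  ext x
  simp only [activeAtom, Atom.vars, HeadTerm.vars, Term.vars_lift, List.mem_map]
  constructor
  · rintro (⟨i, y, hy, rfl⟩ | ⟨_, ⟨t, ht, rfl⟩, hx⟩)
    · exact ⟨y, Or.inl ⟨i, hy⟩, rfl⟩
    · rw [Term.vars_lift] at hx
      obtain ⟨y, hy, rfl⟩ := hx
      exact ⟨y, Or.inr ⟨t, ht, hy⟩, rfl⟩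
  · rintro ⟨y, (⟨i, hy⟩ | ⟨t, ht, hy⟩), rfl⟩
    · exact Or.inl ⟨i, y, hy, rfl⟩
    · exact Or.inr ⟨_, ⟨t, ht, rfl⟩, by rw [Term.vars_lift]; exact ⟨y, hy, rfl⟩⟩

theorem Rule.not_isExistential_active (ρ : Rule S) {i δ p q}
    (hi : ρ.headArgs i = .sample δ p q) : ¬ (ρ.bodyTGD (activeAtom δ p q)).IsExistential := by
  rintro ⟨x, hx, hb⟩
  change x ∈ (activeAtom δ p q).vars at hx
  rw [vars_activeAtom, ← hi] at hx
  obtain ⟨y, hy, rfl⟩ := hx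
  exact hb (ρ.inl_mem_bodyVars _ i hy)

theorem isExistential_atr (k : ℕ) (δ : S.Dist) (p : Fin (S.dim δ) → Term S ℕ)
    (q : List (Term S ℕ)) :
    (⟨[activeAtom δ p q], [], resultAtom k δ p q⟩ : VTGD S).IsExistential := by
  refine ⟨Sum.inr k, Or.inr (Or.inr rfl), ?_⟩
  rintro (⟨b, hb, hx⟩ | ⟨b, hb, hx⟩)
  · rw [List.mem_singleton.1 hb, vars_activeAtom] at hx
    simp at hx
  · simp at hb

theorem Rule.not_isExistential_final (ρ : Rule S) : ¬ ρ.finalTGD.IsExistential := by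
  rintro ⟨x, ⟨i, hx⟩, hb⟩
  change x ∈ ((ρ.headArgs i).replace i).vars at hx
  rcases hi : ρ.headArgs i with t | ⟨δ, p, q⟩
  · rw [hi, HeadTerm.replace, Term.vars_lift] at hx
    obtain ⟨y, hy, rfl⟩ := hx
    obtain ⟨b, hbp, hyb⟩ := ρ.safe_head i y (by rw [hi]; exact hy)
    exact hb (Or.inl ⟨b.lift, List.mem_append_right _ (List.mem_map_of_mem hbp),
      by rw [RelAtom.vars_lift]; exact ⟨y, hyb, rfl⟩⟩)
  · rw [hi] at hx
    obtain rfl : x = Sum.inr i.val := hx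
    refine hb (Or.inl ⟨resultAtom i δ p q, List.mem_append_left _ ?_, Or.inr (Or.inr rfl)⟩)
    exact List.mem_filterMap.2 ⟨i, List.mem_finRange i, by rw [hi]; rfl⟩

/-- The existential head of a TGD `B → ∃ y Result^δ(p, q, y)` holds if and only if some result is
present for `δ`, `p`, `q`. -/
theorem Rule.headHolds_result_iff (ρ : Rule S) {i δ p q} (hi : ρ.headArgs i = .sample δ p q)
    {h : TVar → S.Const} {I : Set (GroundAtom S)} :
    (ρ.bodyTGD (resultAtom i δ p q)).HeadHolds h I ↔
      ∃ o, Atom.result δ (fun j => (p j).lift.eval h)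
        ((q.map Term.lift).map (Term.eval h)) o ∈ I := by
  have key : ∀ k : TVar → S.Const,
      (∀ x ∈ (ρ.bodyTGD (resultAtom i δ p q)).bodyVars, k x = h x) →
      (activeAtom δ p q).map (Term.eval k) = (activeAtom δ p q).map (Term.eval h) := by
    intro k hk
    refine Atom.map_eval_congr fun x hx => hk x ?_
    rw [vars_activeAtom, ← hi] at hx
    obtain ⟨y, hy, rfl⟩ := hx
    exact ρ.inl_mem_bodyVars _ i hy
  simp only [activeAtom, Atom.map, Atom.active.injEq, heq_eq_eq, true_and] at key
  constructor
  · rintro ⟨k, hk, hI⟩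
    refine ⟨k (.inr i), ?_⟩
    rw [← (key k hk).1, ← (key k hk).2]
    exact hI
  · rintro ⟨o, ho⟩
    have hk : ∀ x ∈ (ρ.bodyTGD (resultAtom i δ p q)).bodyVars,
        Function.update h (.inr i.val) o x = h x := by
      intro x hx
      refine Function.update_of_ne ?_ _ _
      rintro rfl
      exact ρ.inr_notMem_bodyVars _ _ hx
    refine ⟨_, hk, ?_⟩
    rw [← (key _ hk).1, ← (key _ hk).2] at ho
    simpa [TGD.subst, Rule.bodyTGD, resultAtom, Atom.map, Term.eval] using ho

/-! ### The existential-free rules of the grounding -/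

/-- The ground instances of the existential-free TGDs of `Σ_Π`. -/
def Program.detRules (Pi : Program S) : Set (GroundRule S) := ground (nonexPart Pi.toTGDs)

/-- The ground instances of the active-to-result TGDs of `Σ_Π`. -/
def Program.choiceRules (Pi : Program S) : Set (GroundRule S) := ground (exPart Pi.toTGDs)

theorem Program.mem_detRules {Pi : Program S} {r : GroundRule S} :
    r ∈ Pi.detRules ↔ ∃ ρ ∈ Pi, ∃ h, r = ρ.finalTGD.subst h ∨
      ∃ i δ p q, ρ.headArgs i = .sample δ p q ∧ r = (ρ.bodyTGD (activeAtom δ p q)).subst h := by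
  constructor
  · rintro ⟨σ, ⟨⟨ρ, hρ, ⟨i, δ, p, q, hi, rfl⟩ | ⟨i, δ, p, q, hi, rfl⟩ | rfl⟩, hne⟩, h, rfl⟩
    · exact ⟨ρ, hρ, h, Or.inr ⟨i, δ, p, q, hi, rfl⟩⟩
    · exact absurd (isExistential_atr _ δ p q) hne
    · exact ⟨ρ, hρ, h, Or.inl rfl⟩
  · rintro ⟨ρ, hρ, h, rfl | ⟨i, δ, p, q, hi, rfl⟩⟩
    · exact ⟨_, ⟨⟨ρ, hρ, Or.inr (Or.inr rfl)⟩, ρ.not_isExistential_final⟩, h, rfl⟩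
    · exact ⟨_, ⟨⟨ρ, hρ, Or.inl ⟨i, δ, p, q, hi, rfl⟩⟩, ρ.not_isExistential_active hi⟩, h, rfl⟩

theorem Program.exists_eq_atr_of_mem_choiceRules {Pi : Program S} {r : GroundRule S}
    (hr : r ∈ Pi.choiceRules) : ∃ δ p q o, r = atr δ p q o := by
  obtain ⟨σ, ⟨⟨ρ, hρ, ⟨i, δ, p, q, hi, rfl⟩ | ⟨i, δ, p, q, hi, rfl⟩ | rfl⟩, hex⟩, h, rfl⟩ := hr
  · exact absurd hex (ρ.not_isExistential_active hi)
  · exact ⟨_, _, _, _, rfl⟩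
  · exact absurd hex ρ.not_isExistential_final

theorem Program.neg_eq_nil_of_mem_detRules {Pi : Program S} (hpos : Pi.IsPositive)
    {r : GroundRule S} (hr : r ∈ Pi.detRules) : r.neg = [] := by
  obtain ⟨ρ, hρ, h, rfl | ⟨i, δ, p, q, hi, rfl⟩⟩ := mem_detRules.1 hr <;>
  simp [TGD.subst, Rule.finalTGD, Rule.bodyTGD, hpos ρ hρ]

theorem Program.head_ne_result_of_mem_detRules {Pi : Program S} {r : GroundRule S}
    (hr : r ∈ Pi.detRules) (δ p q o) : r.head ≠ .result δ p q o := by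
  obtain ⟨ρ, hρ, h, rfl | ⟨i, δ, p, q, hi, rfl⟩⟩ := mem_detRules.1 hr <;>
  simp [TGD.subst, Rule.finalTGD, Rule.bodyTGD, activeAtom, Atom.map]

theorem Program.ne_active_of_mem_pos {Pi : Program S} {r : GroundRule S}
    (hr : r ∈ Pi.detRules) {a} (ha : a ∈ r.pos) (δ p q) : a ≠ .active δ p q := by
  rintro rfl
  obtain ⟨ρ, hρ, h, rfl | ⟨i, δ', p', q', hi, rfl⟩⟩ := mem_detRules.1 hr
  · obtain ⟨b, hb, hba⟩ := List.mem_map.1 ha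
    rcases List.mem_append.1 hb with hb | hb
    · obtain ⟨j, -, hj⟩ := List.mem_filterMap.1 hb
      rcases hi : ρ.headArgs j with t | ⟨δ', p', q'⟩ <;>
        rw [hi] at hj <;> simp only [HeadTerm.result?, Option.some.injEq, reduceCtorEq] at hj
      subst hj
      simp [resultAtom, Atom.map] at hba
    · obtain ⟨c, -, rfl⟩ := List.mem_map.1 hb
      simp [RelAtom.lift, Atom.map] at hba
  · obtain ⟨b, hb, hba⟩ := List.mem_map.1 ha
    obtain ⟨c, -, rfl⟩ := List.mem_map.1 hb
    simp [RelAtom.lift, Atom.map] at hba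

/-- Every result may be chosen for an active atom that is the head of a rule. -/
theorem Program.atr_mem_choiceRules {Pi : Program S} {r : GroundRule S} (hr : r ∈ Pi.detRules)
    {δ p q} (hh : r.head = .active δ p q) (o : S.Const) : atr δ p q o ∈ Pi.choiceRules := by
  obtain ⟨ρ, hρ, h, rfl | ⟨i, δ', p', q', hi, rfl⟩⟩ := mem_detRules.1 hr
  · simp [TGD.subst, Rule.finalTGD, Atom.map] at hh
  · simp only [TGD.subst, Rule.bodyTGD] at hh
    have hk : (activeAtom δ' p' q').map (Term.eval (Function.update h (.inr i.val) o)) =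
        .active δ p q := by
      rw [← hh]
      refine Atom.map_eval_congr fun x hx => Function.update_of_ne ?_ _ _
      rw [vars_activeAtom] at hx
      obtain ⟨y, -, rfl⟩ := hx
      simp
    refine ⟨_, ⟨⟨ρ, hρ, Or.inr (Or.inl ⟨i, δ', p', q', hi, rfl⟩)⟩, isExistential_atr _ _ _ _⟩,
      Function.update h (.inr i.val) o, ?_⟩
    simp only [activeAtom, Atom.map, Atom.active.injEq] at hk
    obtain ⟨rfl, hp, hq⟩ := hk
    rw [heq_eq_eq] at hp
    subst hp hq
    have ho : Term.eval (Function.update h (.inr i.val) o) (.var (.inr i.val) : Term S TVar) = o :=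
      Function.update_self _ _ _
    simp only [atr, TGD.subst, activeAtom, resultAtom, Atom.map, ho, List.map_cons, List.map_nil]

/-! ### Models of the BCKOV translation -/

/-- `a` holds in the instance `I` when `Active^δ(p, q)` is read as `∃ y Result^δ(p, q, y)`. -/
def HoldsModActive (I : Set (GroundAtom S)) : GroundAtom S → Prop
  | .active δ p q => ∃ o, Atom.result δ p q o ∈ I
  | a => a ∈ I

theorem holdsModActive_iff_mem {I : Set (GroundAtom S)} {a : GroundAtom S}
    (ha : ∀ δ p q, a ≠ .active δ p q) : HoldsModActive I a ↔ a ∈ I := by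
  cases a with
  | active δ p q => exact absurd rfl (ha δ p q)
  | base a => exact Iff.rfl
  | result δ p q o => exact Iff.rfl

theorem Program.IsPositive.withFacts {Pi : Program S} (hpos : Pi.IsPositive)
    (D : Set (RelAtom S S.Const)) : (Pi.withFacts D).IsPositive := by
  rintro ρ (hρ | ⟨a, -, rfl⟩)
  · exact hpos ρ hρ
  · rfl

theorem Rule.subst_finalTGD_ofFact (a : RelAtom S S.Const) (h : TVar → S.Const) :
    (Rule.ofFact a).finalTGD.subst h = ⟨[], [], .base a⟩ := by
  ext1
  · simp [TGD.subst, Rule.finalTGD, Rule.ofFact, HeadTerm.result?]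
  · rfl
  · rfl

/-- The rules of `Π[D]` are the facts in `D` and the rules of `Π`. -/
theorem Program.mem_detRules_withFacts [Nonempty S.Const] {Pi : Program S}
    {D : Set (RelAtom S S.Const)} {r : GroundRule S} :
    r ∈ (Pi.withFacts D).detRules ↔ (∃ a ∈ D, r = ⟨[], [], .base a⟩) ∨ r ∈ Pi.detRules := by
  rw [mem_detRules, mem_detRules]
  constructor
  · rintro ⟨ρ, hρ | ⟨a, ha, rfl⟩, h, hr⟩
    · exact Or.inr ⟨ρ, hρ, h, hr⟩
    · rcases hr with rfl | ⟨i, δ, p, q, hi, rfl⟩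
      · exact Or.inl ⟨a, ha, Rule.subst_finalTGD_ofFact a h⟩
      · simp [Rule.ofFact] at hi
  · rintro (⟨a, ha, rfl⟩ | ⟨ρ, hρ, h, hr⟩)
    · exact ⟨Rule.ofFact a, Or.inr ⟨a, ha, rfl⟩, fun _ => Classical.arbitrary _,
        Or.inl (Rule.subst_finalTGD_ofFact a _).symm⟩
    · exact ⟨ρ, Or.inl hρ, h, hr⟩

theorem TGD.isTrigger_iff_of_neg_eq_nil {σ : VTGD S} (hσ : σ.neg = []) {h : TVar → S.Const}
    {I : Set (GroundAtom S)} : σ.IsTrigger h I ↔ ∀ a ∈ (σ.subst h).pos, a ∈ I := by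
  simp [TGD.IsTrigger, TGD.subst, hσ]

/-- Each instance of a TGD of `Σ̃_Π` is an instance of an existential-free TGD of `Σ_Π` with the
same body, once `Active^δ(p, q)` is read as `∃ y Result^δ(p, q, y)`. -/
theorem Program.exists_detRule_of_mem_toTGDsBCKOV {Pi : Program S} (hpos : Pi.IsPositive)
    {σ : VTGD S} (hσ : σ ∈ Pi.toTGDsBCKOV) (h : TVar → S.Const) :
    ∃ r ∈ Pi.detRules, (∀ I, σ.IsTrigger h I ↔ ∀ a ∈ r.pos, a ∈ I) ∧
      (∀ I, σ.HeadHolds h I ↔ HoldsModActive I r.head) ∧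
      (((∀ δ p q, r.head ≠ .active δ p q) ∧ (σ.subst h).head = r.head) ∨
        ∃ δ p q o, r.head = .active δ p q ∧ (σ.subst h).head = .result δ p q o) := by
  obtain ⟨ρ, hρ, ⟨i, δ, p, q, hi, rfl⟩ | rfl⟩ := hσ
  · refine ⟨(ρ.bodyTGD (activeAtom δ p q)).subst h,
      mem_detRules.2 ⟨ρ, hρ, h, Or.inr ⟨i, δ, p, q, hi, rfl⟩⟩,
      fun I => TGD.isTrigger_iff_of_neg_eq_nil (by simp [hpos ρ hρ]),
      fun I => ρ.headHolds_result_iff hi, Or.inr ⟨_, _, _, _, rfl, rfl⟩⟩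
  · exact ⟨ρ.finalTGD.subst h, mem_detRules.2 ⟨ρ, hρ, h, Or.inl rfl⟩,
      fun I => TGD.isTrigger_iff_of_neg_eq_nil (by simp [Rule.finalTGD, hpos ρ hρ]),
      fun I => TGD.headHolds_iff_of_not_isExistential ρ.not_isExistential_final,
      Or.inl ⟨by simp [TGD.subst, Rule.finalTGD, Atom.map], rfl⟩⟩

theorem Program.exists_mem_toTGDsBCKOV_of_detRule {Pi : Program S} (hpos : Pi.IsPositive)
    {r : GroundRule S} (hr : r ∈ Pi.detRules) : ∃ σ ∈ Pi.toTGDsBCKOV, ∃ h,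
      (∀ I, σ.IsTrigger h I ↔ ∀ a ∈ r.pos, a ∈ I) ∧
      (∀ I, σ.HeadHolds h I ↔ HoldsModActive I r.head) := by
  obtain ⟨ρ, hρ, h, rfl | ⟨i, δ, p, q, hi, rfl⟩⟩ := mem_detRules.1 hr
  · exact ⟨ρ.finalTGD, ⟨ρ, hρ, Or.inr rfl⟩, h,
      fun I => TGD.isTrigger_iff_of_neg_eq_nil (by simp [Rule.finalTGD, hpos ρ hρ]),
      fun I => TGD.headHolds_iff_of_not_isExistential ρ.not_isExistential_final⟩
  · exact ⟨ρ.bodyTGD (resultAtom i δ p q), ⟨ρ, hρ, Or.inl ⟨i, δ, p, q, hi, rfl⟩⟩, h,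
      fun I => TGD.isTrigger_iff_of_neg_eq_nil (by simp [Rule.bodyTGD, hpos ρ hρ]),
      fun I => ρ.headHolds_result_iff hi⟩

/-- The BCKOV models are the instances closed under the existential-free rules of `Π[D]`, once
`Active^δ(p, q)` is read as `∃ y Result^δ(p, q, y)`. -/
theorem isModelBCKOV_iff [Nonempty S.Const] {Pi : Program S} (hpos : Pi.IsPositive)
    {D : Set (RelAtom S S.Const)} {I : Set (GroundAtom S)} :
    IsModelBCKOV Pi D I ↔
      ∀ r ∈ (Pi.withFacts D).detRules, (∀ a ∈ r.pos, a ∈ I) → HoldsModActive I r.head := by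
  constructor
  · rintro ⟨hD, hI⟩ r hr hpr
    rcases Program.mem_detRules_withFacts.1 hr with ⟨a, ha, rfl⟩ | hr
    · exact hD ⟨a, ha, rfl⟩
    · obtain ⟨σ, hσ, h, h1, h2⟩ := Program.exists_mem_toTGDsBCKOV_of_detRule hpos hr
      exact (h2 I).1 (hI σ hσ h ((h1 I).2 hpr))
  · intro H
    constructor
    · rintro _ ⟨a, ha, rfl⟩
      exact H _ (Program.mem_detRules_withFacts.2 (Or.inl ⟨a, ha, rfl⟩)) (by simp)
    · intro σ hσ h ht
      obtain ⟨r, hr, h1, h2, -⟩ := Program.exists_detRule_of_mem_toTGDsBCKOV hpos hσ h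
      exact (h2 I).2 (H r (Program.mem_detRules_withFacts.2 (Or.inr hr)) ((h1 I).1 ht))

/-! ### Sets of choices and their closures -/

/-- The least model of a set of ground rules, whose negative literals are ignored. -/
inductive LeastModel (N : Set (GroundRule S)) : GroundAtom S → Prop
  | intro (r : GroundRule S) (hr : r ∈ N) (h : ∀ a ∈ r.pos, LeastModel N a) : LeastModel N r.head

/-- The atoms derived from `Σ_Π` when the existential TGDs are replaced with the choices `A`. -/
def Program.closure (Pi : Program S) (A : Set (GroundRule S)) : Set (GroundAtom S) :=
  {a | LeastModel (Pi.detRules ∪ A) a}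

namespace Program

variable {Pi : Program S} {A B : Set (GroundRule S)}

theorem head_mem_closure_of_detRule {r : GroundRule S} (hr : r ∈ Pi.detRules)
    (h : ∀ a ∈ r.pos, a ∈ Pi.closure A) : r.head ∈ Pi.closure A := .intro r (Or.inl hr) h

theorem head_mem_closure_of_choice {r : GroundRule S} (hr : r ∈ A)
    (h : ∀ a ∈ r.pos, a ∈ Pi.closure A) : r.head ∈ Pi.closure A := .intro r (Or.inr hr) h

theorem closure_subset {I : Set (GroundAtom S)}
    (hdet : ∀ r ∈ Pi.detRules, (∀ a ∈ r.pos, a ∈ Pi.closure A) → (∀ a ∈ r.pos, a ∈ I) → r.head ∈ I)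
    (hA : ∀ r ∈ A, (∀ a ∈ r.pos, a ∈ Pi.closure A) → (∀ a ∈ r.pos, a ∈ I) → r.head ∈ I) :
    Pi.closure A ⊆ I := by
  intro a ha
  induction ha with
  | intro r hr h ih =>
    rcases hr with hr | hr
    · exact hdet r hr h ih
    · exact hA r hr h ih

theorem closure_mono (h : A ⊆ B) : Pi.closure A ⊆ Pi.closure B :=
  closure_subset (fun _ hr _ ih => head_mem_closure_of_detRule hr ih)
    (fun _ hr _ ih => head_mem_closure_of_choice (h hr) ih)

variable (Pi) in
/-- The choices in `B` whose active atom is derived. -/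
def fired (B : Set (GroundRule S)) : Set (GroundRule S) := {r ∈ B | ∀ a ∈ r.pos, a ∈ Pi.closure B}

/-- Choices whose active atom is not derived do not contribute to the closure. -/
theorem closure_fired : Pi.closure (Pi.fired B) = Pi.closure B :=
  (closure_mono (Set.sep_subset _ _)).antisymm <|
    closure_subset (fun _ hr _ ih => head_mem_closure_of_detRule hr ih)
      (fun _ hr h ih => head_mem_closure_of_choice ⟨hr, h⟩ ih)

theorem mem_gsimple {r : GroundRule S} :
    r ∈ Pi.gsimple A ↔ r ∈ Pi.detRules ∧ ∀ a ∈ r.pos, a ∈ heads (A ∪ Pi.gsimple A) := by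
  have := OrderHom.map_lfp (simpleStep (nonexPart Pi.toTGDs) A)
  change r ∈ OrderHom.lfp (simpleStep (nonexPart Pi.toTGDs) A) ↔ _
  rw [← this]
  exact Iff.rfl

theorem closure_subset_heads : Pi.closure A ⊆ heads (A ∪ Pi.gsimple A) :=
  closure_subset (fun r hr _ ih => ⟨r, Or.inr (mem_gsimple.2 ⟨hr, ih⟩), rfl⟩)
    (fun r hr _ _ => ⟨r, Or.inl hr, rfl⟩)

/-- The simple grounder does not check that the active atoms of the choices in `A` are derived; if
they are, then it derives exactly the closure. -/
theorem heads_eq_closure (h : ∀ r ∈ A, ∀ a ∈ r.pos, a ∈ Pi.closure A) :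
    heads (A ∪ Pi.gsimple A) = Pi.closure A := by
  refine Set.Subset.antisymm ?_ closure_subset_heads
  have hA : ∀ r ∈ A, r.head ∈ Pi.closure A := fun r hr => head_mem_closure_of_choice hr (h r hr)
  have hG : Pi.gsimple A ⊆ {r | r.head ∈ Pi.closure A} := by
    refine OrderHom.lfp_le _ ?_
    rintro r ⟨hr, hpr⟩
    refine head_mem_closure_of_detRule hr fun a ha => ?_
    obtain ⟨r', hr' | hr', rfl⟩ := hpr a ha
    · exact hA r' hr'
    · exact hr'
  rintro _ ⟨r, hr | hr, rfl⟩
  · exact hA r hr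
  · exact hG hr

/-- An active atom is derived by an existential-free rule only. -/
theorem exists_detRule_of_active_mem_closure (hA : A ⊆ {r | ∃ δ p q o, r = atr δ p q o}) {δ p q}
    (h : .active δ p q ∈ Pi.closure A) :
    ∃ r ∈ Pi.detRules, r.head = .active δ p q ∧ ∀ a ∈ r.pos, a ∈ Pi.closure A := by
  generalize ha : (Atom.active δ p q : GroundAtom S) = a at h
  obtain ⟨r, hr | hr, hpr⟩ := h
  · exact ⟨r, hr, rfl, hpr⟩
  · obtain ⟨δ, p, q, o, rfl⟩ := hA hr
    simp [atr] at ha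

/-- A result is derived by a choice only. -/
theorem exists_choice_of_result_mem_closure (hA : A ⊆ {r | ∃ δ p q o, r = atr δ p q o}) {δ p q o}
    (h : .result δ p q o ∈ Pi.closure A) :
    atr δ p q o ∈ A ∧ .active δ p q ∈ Pi.closure A := by
  generalize ha : (Atom.result δ p q o : GroundAtom S) = a at h
  obtain ⟨r, hr | hr, hpr⟩ := h
  · exact absurd ha.symm (head_ne_result_of_mem_detRules hr _ _ _ _)
  · obtain ⟨δ', p', q', o', rfl⟩ := hA hr
    simp only [atr, Atom.result.injEq] at ha
    obtain ⟨rfl, h2, rfl, rfl⟩ := ha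
    obtain rfl := eq_of_heq h2
    exact ⟨hr, hpr _ (by simp [atr])⟩

variable (Pi) in
/-- `A` is a set of choices that are made one after the other, each for an active atom derived
from earlier ones, and that have positive probability. -/
structure IsPartial (A : Set (GroundRule S)) : Prop where
  subset : A ⊆ Pi.choiceRules
  consistent : ∀ δ p q o o', atr δ p q o ∈ A → atr δ p q o' ∈ A → o = o'
  supported : ∀ r ∈ A, ∀ a ∈ r.pos, a ∈ Pi.closure A
  prob_pos : ∀ δ p q o, atr δ p q o ∈ A → 0 < S.law δ p o

variable (Pi) in
/-- `A` is a set of choices as in `IsPartial` that leaves no choice open. -/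
structure IsComplete (A : Set (GroundRule S)) : Prop extends IsPartial Pi A where
  complete : ∀ δ p q, .active δ p q ∈ Pi.closure A → ∃ o, atr δ p q o ∈ A

theorem subset_atr_of_subset_choiceRules (h : A ⊆ Pi.choiceRules) :
    A ⊆ {r | ∃ δ p q o, r = atr δ p q o} :=
  fun _ hr => exists_eq_atr_of_mem_choiceRules (h hr)

theorem IsPartial.subset_atr (h : Pi.IsPartial A) : A ⊆ {r | ∃ δ p q o, r = atr δ p q o} :=
  subset_atr_of_subset_choiceRules h.subset

end Program

/-- The choices that lead to the results in the instance `I`. -/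
def choicesOf (I : Set (GroundAtom S)) : Set (GroundRule S) :=
  {r | ∃ δ p q o, r = atr δ p q o ∧ .result δ p q o ∈ I}

theorem atr_injective {δ δ' : S.Dist} {p p' q q' o o'}
    (h : (atr δ p q o : GroundRule S) = atr δ' p' q' o') :
    (.result δ p q o : GroundAtom S) = .result δ' p' q' o' := congrArg TGD.head h

theorem atr_mem_choicesOf {I : Set (GroundAtom S)} {δ p q o} :
    atr δ p q o ∈ choicesOf I ↔ .result δ p q o ∈ I := by
  constructor
  · rintro ⟨δ', p', q', o', h, hI⟩
    rwa [atr_injective h]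
  · exact fun h => ⟨δ, p, q, o, rfl, h⟩

theorem choicesOf_moduloActive (I : Set (GroundAtom S)) :
    choicesOf (moduloActive I) = choicesOf I := by
  ext r
  simp [choicesOf, moduloActive]

theorem Program.IsPartial.choicesOf_closure {Pi : Program S} {A : Set (GroundRule S)}
    (h : Pi.IsPartial A) : choicesOf (Pi.closure A) = A := by
  ext r
  constructor
  · rintro ⟨δ, p, q, o, rfl, hr⟩
    exact (exists_choice_of_result_mem_closure h.subset_atr hr).1
  · intro hr
    obtain ⟨δ, p, q, o, rfl⟩ := h.subset_atr hr
    exact atr_mem_choicesOf.2 (head_mem_closure_of_choice hr (h.supported _ hr))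

/-! ### Possible outcomes as complete sets of choices -/

namespace Program

variable {Pi : Program S} {A B : Set (GroundRule S)}

theorem active_notMem_heads (hA : A ⊆ {r | ∃ δ p q o, r = atr δ p q o}) (δ p q) :
    .active δ p q ∉ heads A := by
  rintro ⟨r, hr, h⟩
  obtain ⟨δ', p', q', o', rfl⟩ := hA hr
  simp [atr] at h

theorem active_mem_heads_union (hA : A ⊆ {r | ∃ δ p q o, r = atr δ p q o}) {δ p q}
    {X : Set (GroundRule S)} : .active δ p q ∈ heads (A ∪ X) ↔ .active δ p q ∈ heads X := by
  rw [heads, Set.image_union, Set.mem_union]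
  exact or_iff_right (active_notMem_heads hA δ p q)

/-- In a minimal terminal all choices are supported, since the choices that fire already form a
terminal. -/
theorem supported_of_minimal (h : Minimal (· ∈ Pi.terminals Pi.gsimple) A) :
    ∀ r ∈ A, ∀ a ∈ r.pos, a ∈ Pi.closure A := by
  obtain ⟨⟨⟨hsub, hcons⟩, hcomp⟩, hmin⟩ := h
  have hatr := subset_atr_of_subset_choiceRules hsub
  have hB : Pi.fired A ⊆ A := Set.sep_subset _ _
  have hheads : heads (Pi.fired A ∪ Pi.gsimple (Pi.fired A)) = Pi.closure A := by
    rw [heads_eq_closure, closure_fired]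
    rw [closure_fired]
    exact fun r hr => hr.2
  have hle : A ⊆ Pi.fired A := by
    refine hmin ⟨⟨hB.trans hsub, fun δ p q o o' ho ho' => hcons δ p q o o' (hB ho) (hB ho')⟩, ?_⟩ hB
    intro δ p q ha
    rw [← active_mem_heads_union (hB.trans hatr), hheads] at ha
    obtain ⟨o, ho⟩ := hcomp δ p q ((active_mem_heads_union hatr).1 (closure_subset_heads ha))
    exact ⟨o, ho, by simpa [atr] using ha⟩
  exact fun r hr => (hle hr).2

theorem IsPartial.heads_eq (h : Pi.IsPartial A) : heads (A ∪ Pi.gsimple A) = Pi.closure A :=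
  heads_eq_closure h.supported

theorem IsComplete.minimal (h : Pi.IsComplete A) : Minimal (· ∈ Pi.terminals Pi.gsimple) A := by
  refine ⟨⟨⟨h.subset, h.consistent⟩, fun δ p q ha => h.complete δ p q ?_⟩, ?_⟩
  · rwa [← h.heads_eq, active_mem_heads_union h.subset_atr]
  · rintro B ⟨⟨hBs, -⟩, hB⟩ (hBA : B ⊆ A)
    have key : ∀ r ∈ A, (∀ a ∈ r.pos, a ∈ heads (B ∪ Pi.gsimple B)) → r ∈ B := by
      intro r hr hpr
      obtain ⟨δ, p, q, o, rfl⟩ := h.subset_atr hr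
      obtain ⟨o', ho'⟩ := hB δ p q <|
        (active_mem_heads_union (subset_atr_of_subset_choiceRules hBs)).1 (hpr _ (by simp [atr]))
      rwa [h.consistent δ p q o o' hr (hBA ho')]
    have hcl : Pi.closure A ⊆ heads (B ∪ Pi.gsimple B) :=
      closure_subset (fun r hr _ ih => ⟨r, Or.inr (mem_gsimple.2 ⟨hr, ih⟩), rfl⟩)
        (fun r hr _ ih => ⟨r, Or.inl (key r hr ih), rfl⟩)
    exact fun r hr => key r hr fun a ha => hcl (h.supported r hr a ha)

end Program

variable {Pi : Program S}

/-- The possible outcome given by a complete set of choices. -/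
def Program.IsComplete.outcome {A : Set (GroundRule S)} (h : Pi.IsComplete A) :
    Outcome Pi Pi.gsimple where
  prog := A ∪ Pi.gsimple A
  mem_groundings := ⟨A, h.minimal, rfl⟩
  prob_pos := fun δ p q o ho => by
    rw [h.heads_eq] at ho
    exact h.prob_pos δ p q o (Program.exists_choice_of_result_mem_closure h.subset_atr ho).1

/-- The choices made in a possible outcome. -/
def Outcome.choices (x : Outcome Pi Pi.gsimple) : Set (GroundRule S) := choicesOf (heads x.prog)

theorem Program.IsComplete.choices_outcome {A : Set (GroundRule S)} (h : Pi.IsComplete A) :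
    h.outcome.choices = A := by
  change choicesOf (heads (A ∪ Pi.gsimple A)) = A
  rw [h.heads_eq, h.choicesOf_closure]

theorem Outcome.exists_eq_outcome (x : Outcome Pi Pi.gsimple) :
    ∃ (A : Set (GroundRule S)) (h : Pi.IsComplete A), x = h.outcome := by
  obtain ⟨A, hA, hx⟩ := x.mem_groundings
  have hsup := Program.supported_of_minimal hA
  have hheads := Program.heads_eq_closure hsup
  have hatr := Program.subset_atr_of_subset_choiceRules hA.prop.1.1
  refine ⟨A, ⟨⟨hA.prop.1.1, hA.prop.1.2, hsup, fun δ p q o ho => x.prob_pos δ p q o ?_⟩,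
    fun δ p q ha => hA.prop.2 δ p q ?_⟩, Outcome.ext hx⟩
  · rw [hx]
    exact ⟨_, Or.inl ho, rfl⟩
  · rwa [← Program.active_mem_heads_union hatr, hheads]

theorem Outcome.isComplete (x : Outcome Pi Pi.gsimple) : Pi.IsComplete x.choices := by
  obtain ⟨A, h, rfl⟩ := x.exists_eq_outcome
  rwa [h.choices_outcome]

theorem Outcome.heads_prog (x : Outcome Pi Pi.gsimple) :
    heads x.prog = Pi.closure x.choices := by
  obtain ⟨A, h, rfl⟩ := x.exists_eq_outcome
  rw [h.choices_outcome]
  exact h.heads_eq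

theorem Outcome.prog_eq (x : Outcome Pi Pi.gsimple) :
    x.prog = x.choices ∪ Pi.gsimple x.choices := by
  obtain ⟨A, h, rfl⟩ := x.exists_eq_outcome
  rw [h.choices_outcome]
  rfl

theorem Outcome.choices_injective :
    Function.Injective (Outcome.choices : Outcome Pi Pi.gsimple → Set (GroundRule S)) := by
  intro x y h
  ext1
  rw [x.prog_eq, y.prog_eq, h]

/-- The heads of a possible outcome are its only stable model. -/
theorem Outcome.mem_sms_iff (hpos : Pi.IsPositive) (x : Outcome Pi Pi.gsimple)
    {I : Set (GroundAtom S)} : I ∈ sms x.prog ↔ I = heads x.prog := by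
  have hneg : ∀ r ∈ x.prog, r.neg = [] := by
    intro r hr
    rw [x.prog_eq] at hr
    rcases hr with hr | hr
    · obtain ⟨δ, p, q, o, rfl⟩ := x.isComplete.subset_atr hr
      rfl
    · exact Program.neg_eq_nil_of_mem_detRules hpos (Program.mem_gsimple.1 hr).1
  have hle : ∀ I J, (∀ r ∈ x.prog, r.ReductHolds I J) → heads x.prog ⊆ J := by
    intro I J hJ
    have hrule : ∀ r ∈ x.prog, (∀ a ∈ r.pos, a ∈ J) → r.head ∈ J :=
      fun r hr h => hJ r hr h (by simp [hneg r hr])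
    rw [x.heads_prog]
    refine Program.closure_subset (fun r hr h ih => hrule r ?_ ih) (fun r hr h ih => hrule r ?_ ih)
    · rw [← x.heads_prog, x.prog_eq] at h
      rw [x.prog_eq]
      exact Or.inr (Program.mem_gsimple.2 ⟨hr, h⟩)
    · rw [x.prog_eq]
      exact Or.inl hr
  have hheads : ∀ I, ∀ r ∈ x.prog, r.ReductHolds I (heads x.prog) := fun I r hr _ _ => ⟨r, hr, rfl⟩
  constructor
  · rintro ⟨h1, h2⟩
    by_contra hne
    exact h2 ⟨heads x.prog, ⟨hle I I h1, fun h => hne (h.antisymm (hle I I h1))⟩, hheads I⟩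
  · rintro rfl
    exact ⟨hheads _, fun ⟨J, hJ, hJ'⟩ => hJ.2 (hle _ J hJ')⟩

/-! ### Products of probabilities -/

/-- Only the results of an instance contribute to its probability. -/
theorem atomsProb_eq_choicesOf (I : Set (GroundAtom S)) :
    atomsProb I = atomsProb (heads (choicesOf I)) := by
  rw [atomsProb, atomsProb]
  refine finprod_mem_inter_mulSupport_eq _ _ _ ?_
  ext a
  refine and_congr_left fun ha => ?_
  cases a with
  | base a => exact absurd rfl ha
  | active δ p q => exact absurd rfl ha
  | result δ p q o =>
    constructor
    · exact fun h => ⟨atr δ p q o, atr_mem_choicesOf.2 h, rfl⟩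
    · rintro ⟨_, ⟨δ', p', q', o', rfl, hI⟩, h⟩
      exact h ▸ hI

theorem Outcome.pr_eq (x : Outcome Pi Pi.gsimple) : x.pr = atomsProb (heads x.choices) :=
  atomsProb_eq_choicesOf _

theorem atomsProb_insert_atr {A : Set (GroundRule S)} (hfin : A.Finite) {δ p q o}
    (h : .result δ p q o ∉ heads A) :
    atomsProb (heads (insert (atr δ p q o) A)) = atomsProb (heads A) * S.law δ p o := by
  rw [heads, Set.image_insert_eq, atomsProb, mul_comm]
  exact finprod_mem_insert _ h (hfin.image _)

/-! ### The total mass of the outcomes that extend a set of choices -/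

namespace Program

variable {A : Set (GroundRule S)}

theorem isPartial_empty : Pi.IsPartial ∅ := by
  constructor <;> simp

/-- An open choice of a partial set of choices can be made arbitrarily, as long as it has positive
probability. -/
theorem IsPartial.insert_atr (h : Pi.IsPartial A) {δ p q}
    (hact : .active δ p q ∈ Pi.closure A) (hopen : ∀ o, atr δ p q o ∉ A) {o : S.Const}
    (ho : 0 < S.law δ p o) : Pi.IsPartial (insert (atr δ p q o) A) := by
  have hmem : ∀ {δ' p' q' o'}, (atr δ' p' q' o' : GroundRule S) ∈ insert (atr δ p q o) A →
      (.result δ' p' q' o' : GroundAtom S) = .result δ p q o ∨ atr δ' p' q' o' ∈ A :=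
    fun h => h.imp_left atr_injective
  constructor
  · obtain ⟨r, hr, hh, -⟩ := exists_detRule_of_active_mem_closure h.subset_atr hact
    exact Set.insert_subset (atr_mem_choiceRules hr hh o) h.subset
  · intro δ' p' q' o₁ o₂ h₁ h₂
    rcases hmem h₁ with e₁ | h₁' <;> rcases hmem h₂ with e₂ | h₂'
    · simpa using e₁.trans e₂.symm
    · simp only [Atom.result.injEq] at e₁
      obtain ⟨rfl, hp, rfl, rfl⟩ := e₁
      obtain rfl := eq_of_heq hp
      exact absurd h₂' (hopen _)
    · simp only [Atom.result.injEq] at e₂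
      obtain ⟨rfl, hp, rfl, rfl⟩ := e₂
      obtain rfl := eq_of_heq hp
      exact absurd h₁' (hopen _)
    · exact h.consistent _ _ _ _ _ h₁' h₂'
  · have hmono : Pi.closure A ⊆ Pi.closure (insert (atr δ p q o) A) :=
      closure_mono (Set.subset_insert _ _)
    rintro r (rfl | hr) a ha
    · rw [List.mem_singleton.1 ha]
      exact hmono hact
    · exact hmono (h.supported r hr a ha)
  · intro δ' p' q' o' h'
    rcases hmem h' with e | h'
    · simp only [Atom.result.injEq] at e
      obtain ⟨rfl, hp, rfl, rfl⟩ := e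
      obtain rfl := eq_of_heq hp
      exact ho
    · exact h.prob_pos _ _ _ _ h'

theorem isPartial_sUnion {c : Set (Set (GroundRule S))} (hc : ∀ A ∈ c, Pi.IsPartial A)
    (hchain : IsChain (· ⊆ ·) c) : Pi.IsPartial (⋃₀ c) := by
  constructor
  · exact Set.sUnion_subset fun A hA => (hc A hA).subset
  · rintro δ p q o o' ⟨A, hA, ho⟩ ⟨B, hB, ho'⟩
    rcases hchain.total hA hB with hAB | hAB
    · exact (hc B hB).consistent _ _ _ _ _ (hAB ho) ho'
    · exact (hc A hA).consistent _ _ _ _ _ ho (hAB ho')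
  · rintro r ⟨A, hA, hr⟩ a ha
    exact closure_mono (Set.subset_sUnion_of_mem hA) ((hc A hA).supported r hr a ha)
  · rintro δ p q o ⟨A, hA, ho⟩
    exact (hc A hA).prob_pos _ _ _ _ ho

theorem exists_law_pos (δ : S.Dist) (p : Fin (S.dim δ) → S.Const) : ∃ o, 0 < S.law δ p o := by
  obtain ⟨o, ho⟩ := (S.law δ p).support_nonempty
  exact ⟨o, pos_iff_ne_zero.2 ((PMF.mem_support_iff _ _).1 ho)⟩

/-- By Zorn's lemma: a maximal partial set of choices leaves no choice open. -/
theorem IsPartial.exists_isComplete (h : Pi.IsPartial A) : ∃ B, A ⊆ B ∧ Pi.IsComplete B := by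
  obtain ⟨B, hAB, hB⟩ := zorn_subset_nonempty {B | Pi.IsPartial B}
    (fun c hc hchain _ => ⟨⋃₀ c, isPartial_sUnion hc hchain, fun _ => Set.subset_sUnion_of_mem⟩) A h
  refine ⟨B, hAB, hB.prop, fun δ p q hact => ?_⟩
  by_contra! hopen
  obtain ⟨o, ho⟩ := exists_law_pos δ p
  exact hopen o (hB.le_of_ge (IsPartial.insert_atr hB.prop hact hopen ho) (Set.subset_insert _ _)
    (Set.mem_insert _ _))

theorem IsPartial.finite (hfin : FinitelyGrounding Pi Pi.gsimple) (h : Pi.IsPartial A) :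
    A.Finite := by
  obtain ⟨B, hAB, hB⟩ := h.exists_isComplete
  exact (hfin hB.outcome).subset (hAB.trans Set.subset_union_left)

theorem IsComplete.eq_of_subset {B : Set (GroundRule S)} (hA : Pi.IsComplete A)
    (hB : Pi.IsComplete B) (h : A ⊆ B) : A = B :=
  h.antisymm (hB.minimal.le_of_le hA.minimal.prop h)

/-- The total probability of the possible outcomes in which the choices in `A` are made. -/
noncomputable def mass (Pi : Program S) (A : Set (GroundRule S)) : ℝ≥0∞ :=
  ∑' x : Outcome Pi Pi.gsimple, {x | A ⊆ x.choices}.indicator Outcome.pr x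

theorem IsComplete.mass_eq (h : Pi.IsComplete A) : Pi.mass A = atomsProb (heads A) := by
  rw [mass, tsum_eq_single h.outcome]
  · rw [Set.indicator_of_mem, Outcome.pr_eq, h.choices_outcome]
    exact h.choices_outcome.ge
  · intro x hx
    refine Set.indicator_of_notMem (fun hAx => hx ?_) _
    apply Outcome.choices_injective
    rw [h.choices_outcome, h.eq_of_subset x.isComplete hAx]

/-- Every outcome makes exactly one choice for each derived active atom. -/
theorem mass_eq_tsum {δ p q} (hact : .active δ p q ∈ Pi.closure A) :
    Pi.mass A = ∑' o, Pi.mass (insert (atr δ p q o) A) := by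
  simp only [mass]
  rw [ENNReal.tsum_comm]
  refine tsum_congr fun x => ?_
  by_cases hx : A ⊆ x.choices
  · obtain ⟨o, ho⟩ := x.isComplete.complete δ p q (closure_mono hx hact)
    rw [tsum_eq_single o]
    · rw [Set.indicator_of_mem hx, Set.indicator_of_mem]
      exact Set.insert_subset ho hx
    · intro o' ho'
      refine Set.indicator_of_notMem (fun h => ho' ?_) _
      exact x.isComplete.consistent _ _ _ _ _ (h (Set.mem_insert _ _)) ho
  · rw [Set.indicator_of_notMem hx]
    refine (ENNReal.tsum_eq_zero.2 fun o => Set.indicator_of_notMem (fun h => hx ?_) _).symm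
    exact (Set.subset_insert _ _).trans h

/-- No outcome makes a choice of probability zero. -/
theorem mass_eq_zero {δ p q o} (h : atr δ p q o ∈ A) (ho : S.law δ p o = 0) : Pi.mass A = 0 := by
  refine ENNReal.tsum_eq_zero.2 fun x => Set.indicator_of_notMem (fun hx => ?_) _
  exact (x.isComplete.prob_pos _ _ _ _ (hx h)).ne' ho

/-- Given the choices in `A`, the process of making the remaining choices terminates almost
surely: a counterexample that is maximal (it exists by Zorn's lemma, because unions of chains of
partial sets of choices are finite) would have an open choice, for which the claim holds whatever
is chosen. -/
theorem IsPartial.mass_eq (hfin : FinitelyGrounding Pi Pi.gsimple) (h : Pi.IsPartial A) :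
    Pi.mass A = atomsProb (heads A) := by
  by_contra hne
  obtain ⟨M, -, hM⟩ := zorn_subset_nonempty
    {B | Pi.IsPartial B ∧ Pi.mass B ≠ atomsProb (heads B)} (fun c hc hchain hcne => by
      have hU : Pi.IsPartial (⋃₀ c) := isPartial_sUnion (fun B hB => (hc hB).1) hchain
      obtain ⟨B, hB, hUB⟩ := hchain.directedOn.exists_mem_subset_of_finite_of_subset_sUnion
        hcne (hU.finite hfin) subset_rfl
      exact ⟨B, hc hB, fun C hC => (Set.subset_sUnion_of_mem hC).trans hUB⟩) A ⟨h, hne⟩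
  obtain ⟨hMp, hMne⟩ := hM.prop
  refine hMne ?_
  by_cases hMc : Pi.IsComplete M
  · exact hMc.mass_eq
  obtain ⟨δ, p, q, hact, hopen⟩ :
      ∃ δ p q, .active δ p q ∈ Pi.closure M ∧ ∀ o, atr δ p q o ∉ M := by
    by_contra! H
    exact hMc ⟨hMp, H⟩
  have hstep : ∀ o, Pi.mass (insert (atr δ p q o) M) = atomsProb (heads M) * S.law δ p o := by
    intro o
    rcases eq_or_ne (S.law δ p o) 0 with ho | ho
    · rw [mass_eq_zero (Set.mem_insert _ _) ho, ho, mul_zero]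
    · rw [← atomsProb_insert_atr (hMp.finite hfin)]
      · by_contra hbad
        exact hopen o <| hM.le_of_ge
          ⟨hMp.insert_atr hact hopen (pos_iff_ne_zero.2 ho), hbad⟩ (Set.subset_insert _ _)
          (Set.mem_insert _ _)
      · rintro ⟨r, hr, hrh⟩
        obtain ⟨δ', p', q', o', rfl⟩ := hMp.subset_atr hr
        simp only [atr, Atom.result.injEq] at hrh
        obtain ⟨rfl, hp, rfl, rfl⟩ := hrh
        obtain rfl := eq_of_heq hp
        exact hopen _ hr
  rw [mass_eq_tsum hact, tsum_congr hstep, ENNReal.tsum_mul_left, PMF.tsum_coe, mul_one]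

theorem tsum_pr (hfin : FinitelyGrounding Pi Pi.gsimple) :
    ∑' x : Outcome Pi Pi.gsimple, x.pr = 1 := by
  have := isPartial_empty.mass_eq hfin
  simpa [mass, heads, atomsProb] using this

end Program

/-! ### The space induced by the simple grounder -/

section Grounder

variable {Pi : Program S}

theorem Outcome.pr_ne_zero (x : Outcome Pi Pi.gsimple) : x.pr ≠ 0 := by
  refine finprod_mem_induction (p := fun t : ℝ≥0∞ => t ≠ 0) one_ne_zero
    (fun _ _ => mul_ne_zero) fun a ha => ?_
  cases a with
  | base a => exact one_ne_zero
  | active δ p q => exact one_ne_zero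
  | result δ p q o => exact (x.prob_pos _ _ _ _ ha).ne'

theorem Outcome.countable (hfin : FinitelyGrounding Pi Pi.gsimple) :
    Countable (Outcome Pi Pi.gsimple) := by
  have h := Summable.countable_support_ennreal
    (f := fun x : Outcome Pi Pi.gsimple => x.pr) (by rw [Program.tsum_pr hfin]; simp)
  rw [Function.support_eq_univ fun x => x.pr_ne_zero] at h
  exact Set.countable_univ_iff.1 h

/-- Different outcomes have different stable models. -/
theorem Outcome.isBlock_singleton (hpos : Pi.IsPositive)
    (hfin : FinitelyGrounding Pi Pi.gsimple) (x : Outcome Pi Pi.gsimple) :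
    Outcome.IsBlock Pi Pi.gsimple {x} := by
  refine ⟨⟨fun y _ => hfin y, by simp⟩, fun E hE hxE y hy => ?_⟩
  have h : heads y.prog ∈ sms x.prog := by
    rw [← hE.2 y hy x (hxE rfl)]
    exact (y.mem_sms_iff hpos).2 rfl
  exact Outcome.choices_injective (congrArg choicesOf ((x.mem_sms_iff hpos).1 h))

theorem Outcome.discreteMeasurableSpace (hpos : Pi.IsPositive)
    (hfin : FinitelyGrounding Pi Pi.gsimple) :
    DiscreteMeasurableSpace (Outcome Pi Pi.gsimple) := by
  have := Outcome.countable hfin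
  have : MeasurableSingletonClass (Outcome Pi Pi.gsimple) :=
    ⟨fun x => MeasurableSpace.measurableSet_generateFrom
      (Or.inr (Outcome.isBlock_singleton hpos hfin x))⟩
  infer_instance

/-- The measure that gives each possible outcome its probability as a point mass. -/
noncomputable def Outcome.measure (Pi : Program S) : Measure (Outcome Pi Pi.gsimple) :=
  Measure.sum fun x : Outcome Pi Pi.gsimple => x.pr • Measure.dirac x

theorem Outcome.measure_apply (hpos : Pi.IsPositive) (hfin : FinitelyGrounding Pi Pi.gsimple)
    (E : Set (Outcome Pi Pi.gsimple)) :
    Outcome.measure Pi E = ∑' x, E.indicator Outcome.pr x := by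
  have := Outcome.discreteMeasurableSpace hpos hfin
  rw [Outcome.measure, Measure.sum_apply _ (MeasurableSet.of_discrete)]
  refine tsum_congr fun x => ?_
  rw [Measure.smul_apply, Measure.dirac_apply, smul_eq_mul]
  by_cases hx : x ∈ E <;> simp [hx]

theorem Outcome.isOutputMeasure_measure (hpos : Pi.IsPositive)
    (hfin : FinitelyGrounding Pi Pi.gsimple) :
    IsOutputMeasure Pi Pi.gsimple (Outcome.measure Pi) := by
  have hE := Outcome.measure_apply hpos hfin
  have huniv : Outcome.measure Pi Set.univ = 1 := by
    rw [hE, Set.indicator_univ, Program.tsum_pr hfin]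
  refine ⟨⟨huniv⟩, fun E _ => by rw [hE, tsum_subtype], ?_⟩
  have hf : Outcome.fin Pi Pi.gsimple = Set.univ := Set.eq_univ_of_forall hfin
  have hi : Outcome.inf Pi Pi.gsimple = ∅ :=
    Set.eq_empty_of_forall_notMem fun x hx => hx (hfin x)
  rw [tsum_subtype (Outcome.fin Pi Pi.gsimple) Outcome.pr, ← hE, hf, huniv, hi]
  simp

theorem IsOutputMeasure.eq_measure (hpos : Pi.IsPositive)
    (hfin : FinitelyGrounding Pi Pi.gsimple) {P : Measure (Outcome Pi Pi.gsimple)}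
    (hP : IsOutputMeasure Pi Pi.gsimple P) : P = Outcome.measure Pi := by
  have := Outcome.countable hfin
  have := Outcome.discreteMeasurableSpace hpos hfin
  refine Measure.ext_of_singleton fun x => ?_
  rw [hP.block _ (Outcome.isBlock_singleton hpos hfin x),
    (Outcome.isOutputMeasure_measure hpos hfin).block _ (Outcome.isBlock_singleton hpos hfin x)]

end Grounder

/-! ### The bijection between the two sets of possible outcomes -/

/-- A possible outcome is the only one that contains its derived atoms, by minimality. -/
theorem OutcomeBCKOV.above_eq_singleton {Pi : Program S} {D : Set (RelAtom S S.Const)}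
    (I : OutcomeBCKOV Pi D) {F : Set (GroundAtom S)}
    (hF : Atom.base '' D ∪ F = I.inst) : OutcomeBCKOV.above Pi D F = {I} := by
  ext J
  constructor
  · intro hJ
    have hIJ : I.inst ⊆ J.inst := hF ▸ Set.union_subset J.minimal.prop.1 hJ
    exact OutcomeBCKOV.ext ((J.minimal.le_of_le I.minimal.prop hIJ).antisymm hIJ)
  · rintro rfl
    exact (Set.subset_union_right (s := Atom.base '' D)).trans hF.subset

section Bijection

variable [Nonempty S.Const] {Pi : Program S} {D : Set (RelAtom S S.Const)}

/-- A model contained in the heads of an outcome has, by consistency, the same result as the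
outcome for each derived active atom. -/
theorem Outcome.minimal_moduloActive (hpos : Pi.IsPositive)
    (x : Outcome (Pi.withFacts D) (Pi.withFacts D).gsimple) :
    Minimal (IsModelBCKOV Pi D) (moduloActive (heads x.prog)) := by
  rw [x.heads_prog]
  have hx := x.isComplete
  have hres : ∀ {δ p q o}, atr δ p q o ∈ x.choices →
      .result δ p q o ∈ (Pi.withFacts D).closure x.choices :=
    fun h => Program.head_mem_closure_of_choice h (hx.supported _ h)
  constructor
  · refine (isModelBCKOV_iff hpos).2 fun r hr hpr => ?_
    have hh := Program.head_mem_closure_of_detRule hr fun a ha => (hpr a ha).1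
    generalize r.head = a at hh
    cases a with
    | base a => exact ⟨hh, by simp⟩
    | active δ p q =>
      obtain ⟨o, ho⟩ := hx.complete δ p q hh
      exact ⟨o, hres ho, by simp⟩
    | result δ p q o => exact ⟨hh, by simp⟩
  · intro I hI hIx
    rw [isModelBCKOV_iff hpos] at hI
    have hsub : (Pi.withFacts D).closure x.choices ⊆ {a | HoldsModActive I a} := by
      refine Program.closure_subset (fun r hr _ ih => hI r hr fun a ha => ?_) fun r hr _ ih => ?_
      · exact (holdsModActive_iff_mem (Program.ne_active_of_mem_pos hr ha)).1 (ih a ha)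
      · obtain ⟨δ, p, q, o, rfl⟩ := hx.subset_atr hr
        obtain ⟨o', ho'⟩ := ih _ List.mem_cons_self
        have h' := (Program.exists_choice_of_result_mem_closure hx.subset_atr (hIx ho').1).1
        rw [hx.consistent δ p q o o' hr h']
        exact ho'
    exact fun a ha => (holdsModActive_iff_mem ha.2).1 (hsub ha.1)

/-- The stable model of a possible outcome modulo active, as a BCKOV possible outcome. -/
def Outcome.toBCKOV (hpos : Pi.IsPositive)
    (x : Outcome (Pi.withFacts D) (Pi.withFacts D).gsimple) : OutcomeBCKOV Pi D where
  inst := moduloActive (heads x.prog)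
  minimal := x.minimal_moduloActive hpos
  prob_pos := fun δ p q o h => x.prob_pos δ p q o h.1

theorem Outcome.toBCKOV_injective (hpos : Pi.IsPositive) :
    Function.Injective (Outcome.toBCKOV hpos :
      Outcome (Pi.withFacts D) (Pi.withFacts D).gsimple → OutcomeBCKOV Pi D) := by
  intro x y h
  apply Outcome.choices_injective
  have := congrArg (fun I => choicesOf I.inst) h
  simpa only [Outcome.toBCKOV, choicesOf_moduloActive, Outcome.choices] using this

theorem Outcome.toBCKOV_surjective (hpos : Pi.IsPositive) :
    Function.Surjective (Outcome.toBCKOV hpos :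
      Outcome (Pi.withFacts D) (Pi.withFacts D).gsimple → OutcomeBCKOV Pi D) := by
  intro I
  have hI := (isModelBCKOV_iff hpos).1 I.minimal.prop
  -- One result in `I` is chosen for each active atom; the choices that fire are complete.
  let B : Set (GroundRule S) :=
    {r | ∃ δ p q, ∃ h : ∃ o, Atom.result δ p q o ∈ I.inst, r = atr δ p q h.choose}
  have hBatr : B ⊆ {r | ∃ δ p q o, r = atr δ p q o} := by
    rintro _ ⟨δ, p, q, h, rfl⟩
    exact ⟨δ, p, q, _, rfl⟩
  have hBI : ∀ {δ p q o}, atr δ p q o ∈ B → .result δ p q o ∈ I.inst := by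
    rintro δ p q o ⟨δ', p', q', h, hr⟩
    rw [atr_injective hr]
    exact h.choose_spec
  have hBcons : ∀ {δ p q o}, atr δ p q o ∈ B →
      ∃ h : ∃ o, Atom.result δ p q o ∈ I.inst, o = h.choose := by
    rintro δ p q o ⟨δ', p', q', h, hr⟩
    have e := atr_injective hr
    simp only [Atom.result.injEq] at e
    obtain ⟨rfl, hp, rfl, ho⟩ := e
    obtain rfl := eq_of_heq hp
    exact ⟨h, ho⟩
  have hsub : (Pi.withFacts D).closure B ⊆ {a | HoldsModActive I.inst a} := by
    refine Program.closure_subset (fun r hr _ ih => hI r hr fun a ha => ?_) fun r hr _ ih => ?_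
    · exact (holdsModActive_iff_mem (Program.ne_active_of_mem_pos hr ha)).1 (ih a ha)
    · obtain ⟨δ, p, q, o, rfl⟩ := hBatr hr
      exact hBI hr
  have hA : (Pi.withFacts D).IsComplete ((Pi.withFacts D).fired B) := by
    constructor
    · constructor
      · rintro r ⟨hr, hpr⟩
        obtain ⟨δ, p, q, o, rfl⟩ := hBatr hr
        obtain ⟨r', hr', hh, -⟩ := Program.exists_detRule_of_active_mem_closure hBatr
          (hpr _ List.mem_cons_self)
        exact Program.atr_mem_choiceRules hr' hh o
      · intro δ p q o o' ho ho'
        obtain ⟨h, rfl⟩ := hBcons ho.1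
        obtain ⟨h', rfl⟩ := hBcons ho'.1
        rfl
      · rw [Program.closure_fired]
        exact fun r hr => hr.2
      · exact fun δ p q o ho => I.prob_pos δ p q o (hBI ho.1)
    · intro δ p q hact
      rw [Program.closure_fired] at hact
      have h : ∃ o, Atom.result δ p q o ∈ I.inst := hsub hact
      refine ⟨h.choose, ⟨δ, p, q, h, rfl⟩, fun a ha => ?_⟩
      rw [List.mem_singleton.1 ha]
      exact hact
  refine ⟨hA.outcome, ?_⟩
  ext1
  have hle : (hA.outcome.toBCKOV hpos).inst ⊆ I.inst := by
    rintro a ⟨ha, hna⟩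
    rw [hA.outcome.heads_prog, hA.choices_outcome, Program.closure_fired] at ha
    exact (holdsModActive_iff_mem hna).1 (hsub ha)
  exact hle.antisymm (I.minimal.le_of_le (hA.outcome.toBCKOV hpos).minimal.prop hle)

theorem OutcomeBCKOV.finite (hpos : Pi.IsPositive)
    (hfin : FinitelyGrounding (Pi.withFacts D) (Pi.withFacts D).gsimple) (I : OutcomeBCKOV Pi D) :
    I.inst.Finite := by
  obtain ⟨x, rfl⟩ := Outcome.toBCKOV_surjective hpos I
  exact ((hfin x).image _).subset (Set.sep_subset _ _)

theorem OutcomeBCKOV.countable (hpos : Pi.IsPositive)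
    (hfin : FinitelyGrounding (Pi.withFacts D) (Pi.withFacts D).gsimple) :
    Countable (OutcomeBCKOV Pi D) :=
  have := Outcome.countable hfin
  (Outcome.toBCKOV_surjective hpos).countable

theorem OutcomeBCKOV.discreteMeasurableSpace (hpos : Pi.IsPositive)
    (hfin : FinitelyGrounding (Pi.withFacts D) (Pi.withFacts D).gsimple) :
    DiscreteMeasurableSpace (OutcomeBCKOV Pi D) := by
  have := OutcomeBCKOV.countable hpos hfin
  have : MeasurableSingletonClass (OutcomeBCKOV Pi D) :=
    ⟨fun I => MeasurableSpace.measurableSet_generateFrom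
      ⟨I.inst, I.finite hpos hfin, (I.above_eq_singleton
        (Set.union_eq_self_of_subset_left I.minimal.prop.1)).symm⟩⟩
  infer_instance

end Bijection

/-! ### Derivations -/

section Derivation

variable {Pi : Program S} {D : Set (RelAtom S S.Const)} {l : List (GroundAtom S)}

/-- A TGD whose head is already present is not applicable. -/
theorem IsDerivation.nodup (hl : IsDerivation Pi D l) : l.Nodup := by
  refine List.pairwise_iff_getElem.2 fun i j hi hj hij heq => ?_
  obtain ⟨σ, -, h, -, hhead, hσ⟩ := hl j hj
  refine hhead ⟨h, fun _ _ => rfl, Or.inr ?_⟩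
  rw [← hσ, ← heq]
  exact List.mem_take_iff_getElem.2 ⟨i, by omega, rfl⟩

theorem IsDerivation.concat (hl : IsDerivation Pi D l) {σ : VTGD S} (hσ : σ ∈ Pi.toTGDsBCKOV)
    {h : TVar → S.Const} (ht : σ.IsTrigger h (Atom.base '' D ∪ {a | a ∈ l}))
    (hh : ¬ σ.HeadHolds h (Atom.base '' D ∪ {a | a ∈ l})) :
    IsDerivation Pi D (l ++ [(σ.subst h).head]) := by
  intro i hi
  rcases Nat.lt_or_ge i l.length with hil | hil
  · rw [List.take_append_of_le_length hil.le, List.getElem_append_left hil]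
    exact hl i hil
  · obtain rfl : i = l.length := by simp at hi; omega
    refine ⟨σ, hσ, h, ?_, ?_, by simp⟩ <;> simpa using by assumption

/-- A finite possible outcome is enumerated, apart from the database, by a derivation: by
minimality, a derivation that does not yet contain all its atoms can be prolonged within it. -/
theorem OutcomeBCKOV.exists_isDerivation (hpos : Pi.IsPositive) (I : OutcomeBCKOV Pi D)
    (hI : I.inst.Finite) :
    ∃ l, IsDerivation Pi D l ∧ Atom.base '' D ∪ {a | a ∈ l} = I.inst := by
  by_contra! H
  -- Otherwise there are derivations of any length within the outcome.
  have hlong : ∀ n, ∃ l : List (GroundAtom S), IsDerivation Pi D l ∧ (∀ a ∈ l, a ∈ I.inst) ∧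
      l.length = n := by
    intro n
    induction n with
    | zero => exact ⟨[], fun i hi => absurd hi (by simp), by simp, rfl⟩
    | succ n ih =>
      obtain ⟨l, hl, hlI, rfl⟩ := ih
      have hsub : Atom.base '' D ∪ {a | a ∈ l} ⊆ I.inst :=
        Set.union_subset I.minimal.prop.1 hlI
      have hnot : ¬ IsModelBCKOV Pi D (Atom.base '' D ∪ {a | a ∈ l}) := fun hmod =>
        H l hl (hsub.antisymm (I.minimal.le_of_le hmod hsub))
      obtain ⟨σ, hσ, h, ht, hh⟩ : ∃ σ ∈ Pi.toTGDsBCKOV, ∃ h,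
          σ.IsTrigger h (Atom.base '' D ∪ {a | a ∈ l}) ∧
          ¬ σ.HeadHolds h (Atom.base '' D ∪ {a | a ∈ l}) := by
        by_contra! hall
        exact hnot ⟨Set.subset_union_left, hall⟩
      obtain ⟨r, -, h1, -, -⟩ := Program.exists_detRule_of_mem_toTGDsBCKOV hpos hσ h
      -- The existential variable takes a value for which the head is an atom of the outcome.
      obtain ⟨k, hk, hkI⟩ := I.minimal.prop.2 σ hσ h
        ((h1 _).2 fun a ha => hsub ((h1 _).1 ht a ha))
      refine ⟨_, hl.concat hσ ((TGD.isTrigger_congr hk).2 ht)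
        (fun hc => hh ((TGD.headHolds_congr hk).1 hc)), ?_, by simp⟩
      intro a ha
      rcases List.mem_append.1 ha with ha | ha
      · exact hlI a ha
      · rw [List.mem_singleton.1 ha]
        exact hkI
  obtain ⟨l, hl, hlI, hlen⟩ := hlong (I.inst.ncard + 1)
  classical
  have hcard := Set.ncard_le_ncard (s := (l.toFinset : Set (GroundAtom S)))
    (fun a ha => hlI a (by simpa using ha)) hI
  rw [Set.ncard_coe_finset, List.toFinset_card_of_nodup hl.nodup] at hcard
  omega

/-- The atoms of a derivation are derived by the grounder from the choices in the derivation, and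
each result in it belongs to an active atom for which there is no earlier result. -/
theorem IsDerivation.mem_closure [Nonempty S.Const] (hpos : Pi.IsPositive)
    (hl : IsDerivation Pi D l) (i : ℕ) (hi : i < l.length) :
    l[i] ∈ moduloActive ((Pi.withFacts D).closure (choicesOf {a | a ∈ l})) ∧
    ∀ δ p q o, l[i] = .result δ p q o →
      (∃ r ∈ (Pi.withFacts D).detRules, r.head = .active δ p q ∧
        .active δ p q ∈ (Pi.withFacts D).closure (choicesOf {a | a ∈ l})) ∧
      ∀ o', .result δ p q o' ∉ l.take i := by
  induction i using Nat.strong_induction_on with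
  | _ i ih =>
  obtain ⟨σ, hσ, h, ht, hh, heq⟩ := hl i hi
  obtain ⟨r, hr, h1, h2, h3⟩ := Program.exists_detRule_of_mem_toTGDsBCKOV hpos hσ h
  have hr' : r ∈ (Pi.withFacts D).detRules := Program.mem_detRules_withFacts.2 (Or.inr hr)
  have hhead : r.head ∈ (Pi.withFacts D).closure (choicesOf {a | a ∈ l}) := by
    refine Program.head_mem_closure_of_detRule hr' fun a ha => ?_
    rcases (h1 _).1 ht a ha with ⟨b, hb, rfl⟩ | ha
    · exact Program.head_mem_closure_of_detRule (r := ⟨[], [], .base b⟩)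
        (Program.mem_detRules_withFacts.2 (Or.inl ⟨b, hb, rfl⟩)) (by simp)
    · obtain ⟨j, hj, rfl⟩ := List.mem_take_iff_getElem.1 ha
      exact (ih j (by omega) (by omega)).1.1
  rw [h2] at hh
  rcases h3 with ⟨hna, h3⟩ | ⟨δ, p, q, o, hact, hres⟩
  · rw [heq, h3]
    exact ⟨⟨hhead, hna⟩, fun δ p q o e =>
      absurd e (Program.head_ne_result_of_mem_detRules hr _ _ _ _)⟩
  · rw [heq, hres]
    rw [hact] at hhead
    refine ⟨⟨Program.head_mem_closure_of_choice (r := atr δ p q o) (atr_mem_choicesOf.2 ?_) ?_,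
      by simp⟩, ?_⟩
    · rw [← hres, ← heq]
      exact List.getElem_mem hi
    · intro a ha
      rw [List.mem_singleton.1 ha]
      exact hhead
    · intro δ' p' q' o' e
      simp only [Atom.result.injEq] at e
      obtain ⟨rfl, hp, rfl, rfl⟩ := e
      obtain rfl := eq_of_heq hp
      refine ⟨⟨r, hr', hact, hhead⟩, fun o' ho' => hh ?_⟩
      rw [hact]
      exact ⟨o', Or.inr ho'⟩

theorem IsDerivation.isPartial [Nonempty S.Const] (hpos : Pi.IsPositive)
    (hl : IsDerivation Pi D l) (hprob : ∀ δ p q o, .result δ p q o ∈ l → 0 < S.law δ p o) :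
    (Pi.withFacts D).IsPartial (choicesOf {a | a ∈ l}) := by
  constructor
  · rintro _ ⟨δ, p, q, o, rfl, ho⟩
    obtain ⟨i, hi, heq⟩ := List.getElem_of_mem ho
    obtain ⟨⟨r, hr, hact, -⟩, -⟩ := (hl.mem_closure hpos i hi).2 _ _ _ _ heq
    exact Program.atr_mem_choiceRules hr hact o
  · intro δ p q o o' ho ho'
    obtain ⟨i, hi, heq⟩ := List.getElem_of_mem (atr_mem_choicesOf.1 ho)
    obtain ⟨j, hj, heq'⟩ := List.getElem_of_mem (atr_mem_choicesOf.1 ho')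
    rcases Nat.lt_trichotomy i j with hij | rfl | hij
    · refine absurd ?_ (((hl.mem_closure hpos j hj).2 _ _ _ _ heq').2 o)
      exact List.mem_take_iff_getElem.2 ⟨i, by omega, heq⟩
    · simpa using heq.symm.trans heq'
    · refine absurd ?_ (((hl.mem_closure hpos i hi).2 _ _ _ _ heq).2 o')
      exact List.mem_take_iff_getElem.2 ⟨j, by omega, heq'⟩
  · rintro _ ⟨δ, p, q, o, rfl, ho⟩ a ha
    obtain ⟨i, hi, heq⟩ := List.getElem_of_mem ho
    obtain ⟨⟨r, -, -, hact⟩, -⟩ := (hl.mem_closure hpos i hi).2 _ _ _ _ heq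
    rw [List.mem_singleton.1 ha]
    exact hact
  · exact fun δ p q o ho => hprob δ p q o (atr_mem_choicesOf.1 ho)

/-- A possible outcome contains a derivation if and only if it makes the same choices. -/
theorem IsDerivation.subset_iff [Nonempty S.Const] (hpos : Pi.IsPositive)
    (hl : IsDerivation Pi D l) (x : Outcome (Pi.withFacts D) (Pi.withFacts D).gsimple) :
    {a | a ∈ l} ⊆ (x.toBCKOV hpos).inst ↔ choicesOf {a | a ∈ l} ⊆ x.choices := by
  constructor
  · rintro h _ ⟨δ, p, q, o, rfl, ho⟩
    exact atr_mem_choicesOf.2 (h ho).1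
  · intro h a ha
    obtain ⟨i, hi, rfl⟩ := List.getElem_of_mem ha
    have := (hl.mem_closure hpos i hi).1
    refine ⟨?_, this.2⟩
    rw [x.heads_prog]
    exact Program.closure_mono h this.1

/-- The choices in a derivation may include one of probability zero; then both sides vanish. -/
theorem IsDerivation.mass_eq [Nonempty S.Const] (hpos : Pi.IsPositive)
    (hfin : FinitelyGrounding (Pi.withFacts D) (Pi.withFacts D).gsimple)
    (hl : IsDerivation Pi D l) :
    (Pi.withFacts D).mass (choicesOf {a | a ∈ l}) = atomsProb {a | a ∈ l} := by
  by_cases hprob : ∀ δ p q o, .result δ p q o ∈ l → 0 < S.law δ p o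
  · rw [(hl.isPartial hpos hprob).mass_eq hfin, ← atomsProb_eq_choicesOf]
  · push Not at hprob
    obtain ⟨δ, p, q, o, ho, h0⟩ := hprob
    rw [nonpos_iff_eq_zero] at h0
    rw [Program.mass_eq_zero (atr_mem_choicesOf.2 ho) h0, atomsProb,
      finprod_mem_eq_finite_toFinset_prod _ (List.finite_toSet l)]
    exact (Finset.prod_eq_zero (i := .result δ p q o) (by simpa using ho) h0).symm

end Derivation

/-! ### The BCKOV space -/

section BCKOV

variable [Nonempty S.Const] {Pi : Program S} {D : Set (RelAtom S S.Const)}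

theorem isOutputMeasureBCKOV_map (hpos : Pi.IsPositive)
    (hfin : FinitelyGrounding (Pi.withFacts D) (Pi.withFacts D).gsimple) :
    IsOutputMeasureBCKOV Pi D
      ((Outcome.measure (Pi.withFacts D)).map (Outcome.toBCKOV hpos)) := by
  have := Outcome.discreteMeasurableSpace (hpos.withFacts D) hfin
  have := OutcomeBCKOV.discreteMeasurableSpace hpos hfin
  have := (Outcome.isOutputMeasure_measure (hpos.withFacts D) hfin).isProbabilityMeasure
  refine ⟨Measure.isProbabilityMeasure_map (Measurable.of_discrete).aemeasurable, fun l hl => ?_⟩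
  rw [Measure.map_apply Measurable.of_discrete MeasurableSet.of_discrete,
    Outcome.measure_apply (hpos.withFacts D) hfin, ← hl.mass_eq hpos hfin, Program.mass]
  have : Outcome.toBCKOV hpos ⁻¹' OutcomeBCKOV.above Pi D {a | a ∈ l} =
      {x | choicesOf {a | a ∈ l} ⊆ x.choices} := Set.ext fun x => hl.subset_iff hpos x
  rw [this]

theorem IsOutputMeasureBCKOV.unique (hpos : Pi.IsPositive)
    (hfin : FinitelyGrounding (Pi.withFacts D) (Pi.withFacts D).gsimple)
    {Q Q' : Measure (OutcomeBCKOV Pi D)} (hQ : IsOutputMeasureBCKOV Pi D Q)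
    (hQ' : IsOutputMeasureBCKOV Pi D Q') : Q = Q' := by
  have := OutcomeBCKOV.countable hpos hfin
  have := OutcomeBCKOV.discreteMeasurableSpace hpos hfin
  refine Measure.ext_of_singleton fun I => ?_
  obtain ⟨l, hl, hI⟩ := I.exists_isDerivation hpos (I.finite hpos hfin)
  rw [← I.above_eq_singleton hI, hQ.derivation l hl, hQ'.derivation l hl]

end BCKOV

end GDatalog

theorem mainTheorem4 (S : GDatalog.Vocabulary.{u, v, w}) [Nonempty S.Const]
    (Pi : GDatalog.Program S) (hPi : Set.Finite Pi) (hpos : Pi.IsPositive)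
    (D : Set (GDatalog.RelAtom S S.Const)) (hD : D.Finite) (hedb : ∀ a ∈ D, a.rel ∈ Pi.edb)
    (hfin : GDatalog.FinitelyGrounding (Pi.withFacts D) (Pi.withFacts D).gsimple) :
    -- both probability spaces exist and are unique
    (∃! P, GDatalog.IsOutputMeasure (Pi.withFacts D) (Pi.withFacts D).gsimple P) ∧
    (∃! Q, GDatalog.IsOutputMeasureBCKOV Pi D Q) ∧
    -- every possible outcome has exactly one stable model
    (∀ x : GDatalog.Outcome (Pi.withFacts D) (Pi.withFacts D).gsimple,
      ∃! I, I ∈ GDatalog.sms x.prog) ∧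
    -- mapping each possible outcome to its stable model modulo active is an isomorphism
    ∃ f : GDatalog.Outcome (Pi.withFacts D) (Pi.withFacts D).gsimple →
        GDatalog.OutcomeBCKOV Pi D,
      (∀ x, ∀ I ∈ GDatalog.sms x.prog, (f x).inst = GDatalog.moduloActive I) ∧
      ∀ P Q, GDatalog.IsOutputMeasure (Pi.withFacts D) (Pi.withFacts D).gsimple P →
        GDatalog.IsOutputMeasureBCKOV Pi D Q → GDatalog.IsProbIso P Q f := by
  have hpos' := hpos.withFacts D
  have hQ := GDatalog.isOutputMeasureBCKOV_map hpos hfin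
  refine ⟨⟨_, GDatalog.Outcome.isOutputMeasure_measure hpos' hfin,
      fun P hP => hP.eq_measure hpos' hfin⟩,
    ⟨_, hQ, fun Q' hQ' => hQ'.unique hpos hfin hQ⟩,
    fun x => ⟨_, (x.mem_sms_iff hpos').2 rfl, fun I hI => (x.mem_sms_iff hpos').1 hI⟩,
    GDatalog.Outcome.toBCKOV hpos, fun x I hI => by
      rw [(x.mem_sms_iff hpos').1 hI]
      rfl,
    fun P Q' hP hQ' => ?_⟩
  rw [hP.eq_measure hpos' hfin, hQ'.unique hpos hfin hQ]
  have := GDatalog.Outcome.discreteMeasurableSpace hpos' hfin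
  have := GDatalog.OutcomeBCKOV.discreteMeasurableSpace hpos hfin
  have hinj := GDatalog.Outcome.toBCKOV_injective (D := D) hpos
  refine ⟨⟨hinj, GDatalog.Outcome.toBCKOV_surjective hpos⟩,
    fun F => iff_of_true MeasurableSet.of_discrete MeasurableSet.of_discrete, fun F _ => ?_⟩
  rw [Measure.map_apply Measurable.of_discrete MeasurableSet.of_discrete, hinj.preimage_image]
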